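/- Conventions. Let $1\le r\le d$. For $w=(x_1,\dots,x_r)\in\mathbb C^r$ let $V_w$ be the $r$-dimensional space of linear combinations $g$ of the $\delta^{(\ell)}(x-\tau)$, where $\tau$ is a coordinate of $w$ and $0\le \ell<$ the number of times $\tau$ occurs in $w$; here $\delta^{(\ell)}(x-\tau)$ acts by $f\mapsto f^{(\ell)}(\tau)$. Put $m_k(g)=g(x^k)$. A pair $(w,g)$ with $g\in V_w$ is a solution of the rank-restricted Prony problem for $\mu^*=(m_0,\dots,m_{2r-1})\in\mathbb C^{2r}$ if $m_k(g)=m_k$ for $k=0,\dots,2r-1$. Let $\Sigma_r\subset\mathbb C^{2d}$ be the set of $(m_0,\dots,m_{2d-1})$ for which the $d\times(d+1)$ Hankel matrix $(m_{i+j})$ has rank $r$ and non-zero upper left $r\times r$ minor, and let $\Sigma_r^*\subset\mathbb C^{2r}$ be its projection to the first $2r$ coordinates. For $\mu^*\in\mathbb C^{2r}$ let $R_{\mu^*}=P_{\mu^*}/Q_{\mu^*}$ (irreducible, $Q_{\mu^*}$ monic, $\deg P_{\mu^*}<\deg Q_{\mu^*}\le r$) be the rational function with $R_{\mu^*}(z)=\sum_{k=0}^{2r-1}m_kz^{-k-1}+O(z^{-2r-1})$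 as $z\to\infty$, when it exists. For $Y\subseteq\{1,\dots,r\}$ with $|Y|=n\geq 1$ let $\Delta_Y(w)$ be the divided difference of order $n-1$ at the nodes $x_i$, $i\in Y$ (the $n$-th Newton coefficient of the Hermite interpolation polynomial). A configuration $\mathcal C$ is a partition of $\{1,\dots,r\}$ into nonempty sets $X_1,\dots,X_s$ of sizes $d_1,\dots,d_s$; $X_{j,\ell}$ denotes the set of the first $\ell$ elements of $X_j$, and $\mathcal B_{\mathcal C}(w)=\{\Delta_{X_{j,\ell}}(w)\}_{1\le j\le s,\,1\le \ell\le d_j}$. The point $w$ is subordinated to $\mathcal C$ if $x_k=x_l$ with $k\neq l$ implies that $k,l$ lie in the same $X_j$. Theorem. Let $\mu_0^*\in\Sigma_r^*$, let $(w_0,g_0)$ be a solution of the rank-restricted Prony problem for $\mu_0^*$, and let $w_0$ be subordinated to a configuration $\mathcal C$. Then there are arbitrarily small open neighbourhoods $U$ of $\mu_0^*$ in $\mathbb C^{2r}$ with the following properties. (1) For every $\mu^*\in U$ the function $R_{\mu^*}$ exists and is unique, and $w_0$ enumerates the roots of $Q_{\mu_0^*}$ with multiplicity (so $\deg Q_{\mu_0^*}=r$).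 There are $\mu_1^*\in U$ for which $Q_{\mu_1^*}$ has $r$ distinct roots that can be enumerated as $w_1=(w_{1,1},\dots,w_{1,r})$ with $|w_{1,i}-w_{0,i}|\le\delta/3$ for all $i$, where $\delta$ is the minimal distance between distinct coordinates of $w_0$ (no condition if there is only one). For any such $(\mu_1^*,w_1)$, let $w(\mu^*)$ be the multivalued function on $U$ obtained by analytic continuation of the enumerated roots $w_1$ of $Q_{\mu_1^*}$ along paths in $U$ on which $Q_{\mu^*}$ has $r$ distinct roots (with limits of such continuations as values at the points $\mu^*$ where roots collide). Then: (2) $w(\mu^*)$ has finitely many values, and at least one, at every point of $U$; it is continuous on $U$ as a multivalued function (its set of values is continuous for the Hausdorff distance), its coordinates are algebraic (they satisfy non-zero polynomial equations $p(\mu^*,y)=0$), and its only value at $\mu_0^*$ is $w_0$. (3) The algorithm solves the problem: for every $\mu^*\in U$ and every value $w$ of $w(\mu^*)$, the family $\mathcal B_{\mathcal C}(w)$ is a basis of $V_w$; the linear system $\sum_{j,\ell}\beta_{j,\ell}\,\Delta_{X_{j,\ell}}(w)(x^k)=m_k$, $k=0,\dots,2r-1$, has exactly one solution $\beta$; and with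 $g=\sum_{j,\ell}\beta_{j,\ell}\Delta_{X_{j,\ell}}(w)$ the pair $(w,g)$ is the solution, unique up to a permutation of the coordinates of $w$, of the rank-restricted Prony problem for $\mu^*$. The Stieltjes transform $g\big(\tfrac1{z-x}\big)$ of $g$ equals $R_{\mu^*}(z)$ for all $z$ outside the nodes. (4) The coefficients $\beta_{j,\ell}$ are continuous functions of the pair $(\mu^*,w)$, where $w$ is a value of $w(\mu^*)$; as functions of $\mu^*$ they are multivalued algebraic functions, with finitely many values at each point, continuous on $U$ as multivalued functions. In particular, they are bounded on $U$, also when nodes collide. -/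

import Mathlib

open Polynomial Filter Topology

noncomputable section

namespace Prony

/-! ### Signals supported at the nodes of `w` -/

/-- The number of times that the value `w i` occurs among the coordinates of `w`. -/
def mult {n : ℕ} (w : Fin n → ℂ) (i : Fin n) : ℕ :=
  (Finset.univ.filter fun k => w k = w i).card

/-- The functional `δ^(ℓ)(x - τ)`, with the convention `δ^(ℓ)(x - τ) f = f^(ℓ)(τ)`, for which the
`k`-th moment is `k (k - 1) ⋯ (k - ℓ + 1) τ ^ (k - ℓ)`. Signals are regarded as functionals on
functions `ℂ → ℂ`; they are only ever applied to functions that are holomorphic near the nodes. -/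
def deltaDeriv (τ : ℂ) (ℓ : ℕ) : (ℂ → ℂ) → ℂ := fun f => iteratedDeriv ℓ f τ

/-- The space `V_w`: all linear combinations of the `δ^(ℓ)(x - τ)`, where `τ` is a coordinate of `w`
and `ℓ` is smaller than the multiplicity of `τ` in `w`. The Prony bundle `P_r` consists of
the pairs `(w, g)` with `w ∈ ℂ^r` and `g ∈ V_w`. -/
def signalSpace {n : ℕ} (w : Fin n → ℂ) : Submodule ℂ ((ℂ → ℂ) → ℂ) :=
  Submodule.span ℂ {φ | ∃ (i : Fin n) (ℓ : ℕ), ℓ < mult w i ∧ φ = deltaDeriv (w i) ℓ}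

/-- The moment `m_k(g) = ∫ x^k g(x) dx`. -/
def moment (g : (ℂ → ℂ) → ℂ) (k : ℕ) : ℂ := g fun x => x ^ k

/-- The Stieltjes transform `∫ g(x) dx / (z - x)`. -/
def stieltjes (g : (ℂ → ℂ) → ℂ) (z : ℂ) : ℂ := g fun x => (z - x)⁻¹

/-- `(w, g)` is a solution of the rank-restricted Prony problem with right-hand side `μ`. -/
def IsPronySolution {r : ℕ} (μ : Fin (2 * r) → ℂ) (w : Fin r → ℂ) (g : (ℂ → ℂ) → ℂ) : Prop :=
  g ∈ signalSpace w ∧ ∀ k : Fin (2 * r), moment g k = μ k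

/-! ### The strata of solvable right-hand sides -/

/-- The `d × (d + 1)` Hankel matrix of `μ = (m_0, …, m_{2d-1})`. -/
def hankel (d : ℕ) (μ : Fin (2 * d) → ℂ) : Matrix (Fin d) (Fin (d + 1)) ℂ :=
  Matrix.of fun i j => μ ⟨i.1 + j.1, by omega⟩

/-- The upper left `e × e` block of the Hankel matrix. -/
def hankelBlock (d e : ℕ) (h : e ≤ d) (μ : Fin (2 * d) → ℂ) : Matrix (Fin e) (Fin e) ℂ :=
  (hankel d μ).submatrix (Fin.castLE h) (Fin.castLE (by omega))

/-- The stratum `Σ_r ⊆ ℂ^{2d}`. -/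
def stratum (d r : ℕ) (h : r ≤ d) : Set (Fin (2 * d) → ℂ) :=
  {μ | (hankel d μ).rank = r ∧ (hankelBlock d r h μ).det ≠ 0}

/-- `Σ_r^* ⊆ ℂ^{2r}`: the projection of `Σ_r` to the first `2r` coordinates. -/
def stratumStar (d r : ℕ) (h : r ≤ d) : Set (Fin (2 * r) → ℂ) :=
  (fun (μ : Fin (2 * d) → ℂ) (k : Fin (2 * r)) => μ (Fin.castLE (by omega) k)) '' stratum d r h

/-! ### The Padé approximant -/

/-- `P / Q` is the solution of the diagonal Padé problem with data `μ = (m_0, …, m_{2r-1})`, written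
as an irreducible fraction with monic denominator, `deg P < deg Q ≤ r`: its expansion at infinity
is `∑_{k < 2r} m_k / z^{k+1} + O(z^{-2r-1})`. -/
structure IsPade {r : ℕ} (μ : Fin (2 * r) → ℂ) (P Q : ℂ[X]) : Prop where
  monic : Q.Monic
  degree_lt : P.degree < Q.degree
  natDegree_le : Q.natDegree ≤ r
  coprime : IsCoprime P Q
  taylor : (fun z : ℂ => P.eval z / Q.eval z - ∑ k : Fin (2 * r), μ k / z ^ (k.1 + 1))
    =O[Bornology.cobounded ℂ] fun z : ℂ => (z ^ (2 * r + 1))⁻¹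

/-- The polynomial `∏ (z - x_i)` of the nodes `w = (x_1, …, x_n)`. -/
def nodePoly {n : ℕ} (w : Fin n → ℂ) : ℂ[X] := ∏ i, (X - C (w i))

/-- `w` enumerates the roots of the denominator `Q_μ` (of degree `r`) of the Padé approximant:
`Q_μ(z) = ∏ (z - x_i)`. -/
def IsPoleVector {r : ℕ} (μ : Fin (2 * r) → ℂ) (w : Fin r → ℂ) : Prop :=
  ∃ P : ℂ[X], IsPade μ P (nodePoly w)

/-! ### The multivalued function `w(μ)` -/

/-- An admissible starting point `(μ₁, w₁)` for the continuation: the roots of `Q_{μ₁}` are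
distinct, `w₁` enumerates them, and they are grouped into clusters around the distinct coordinates
of `w₀`, each root being at distance at most `δ / 3` from its centre, where `δ` is the minimal
distance of two distinct coordinates of `w₀`. -/
structure IsBasePoint {r : ℕ} (U : Set (Fin (2 * r) → ℂ)) (w₀ : Fin r → ℂ)
    (μ₁ : Fin (2 * r) → ℂ) (w₁ : Fin r → ℂ) : Prop where
  mem : μ₁ ∈ U
  pole : IsPoleVector μ₁ w₁
  injective : Function.Injective w₁
  close : ∀ i k l, w₀ k ≠ w₀ l → ‖w₁ i - w₀ i‖ ≤ ‖w₀ k - w₀ l‖ / 3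

/-- The values at `μ` of the multivalued function `w` on `U` that arises by continuation of the
enumeration `w₁` of the roots of `Q_{μ₁}`: one follows the roots of `Q` along paths in `U` from `μ₁`
to `μ` on which these roots are distinct, except possibly at the end point `μ`, where the value
is then the limit. (Simple roots are holomorphic functions of `μ`, so following them continuously
is analytic continuation.) -/
def nodeValues {r : ℕ} (U : Set (Fin (2 * r) → ℂ)) (μ₁ : Fin (2 * r) → ℂ) (w₁ : Fin r → ℂ)
    (μ : Fin (2 * r) → ℂ) : Set (Fin r → ℂ) :=
  {w | ∃ (γ : Path μ₁ μ) (ω : Path w₁ w), ∀ t : unitInterval,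
    γ t ∈ U ∧ IsPoleVector (γ t) (ω t) ∧ (t ≠ 1 → Function.Injective (ω t))}

/-! ### Divided differences -/

/-- `P` is the Hermite interpolation polynomial of `f` at `y_1, …, y_n`. -/
def IsHermite {n : ℕ} (y : Fin n → ℂ) (f : ℂ → ℂ) (P : ℂ[X]) : Prop :=
  P.degree < n ∧ ∀ (i : Fin n) (ℓ : ℕ), ℓ < mult y i →
    (derivative^[ℓ] P).eval (y i) = iteratedDeriv ℓ f (y i)

theorem existsUnique_isHermite {n : ℕ} (y : Fin n → ℂ) (f : ℂ → ℂ) :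
    ∃! P : ℂ[X], IsHermite y f P := by
  classical
  let c : ℂ → ℕ := fun τ => (Finset.univ.filter fun k => y k = τ).card
  let I := Σ τ : {τ // τ ∈ Finset.univ.image y}, Fin (c τ.1)
  let L : Polynomial.degreeLT ℂ n →ₗ[ℂ] (I → ℂ) :=
    { toFun := fun P p => (derivative^[(p.2 : ℕ)] P.1).eval p.1.1
      map_add' := by intro P Q; ext p; simp [iterate_map_add]
      map_smul' := by intro a P; ext p; simp [Polynomial.iterate_derivative_smul] }
  have hmem : ∀ i, y i ∈ Finset.univ.image y := fun i =>
    Finset.mem_image_of_mem _ (Finset.mem_univ i)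
  have hker : ∀ P : ℂ[X], P.degree < n →
      (∀ (i : Fin n) (ℓ : ℕ), ℓ < mult y i → (derivative^[ℓ] P).eval (y i) = 0) → P = 0 := by
    intro P hP h
    by_contra h0
    have hle : (Finset.univ.val.map y) ≤ P.roots := by
      rw [Multiset.le_iff_count]
      intro τ
      rw [Polynomial.count_roots, Multiset.count_map]
      by_cases hτ : ∃ i, y i = τ
      · obtain ⟨i, rfl⟩ := hτ
        have hcard : (Multiset.filter (fun a => y i = y a) Finset.univ.val).card = mult y i := by
          simp only [mult, Finset.card_def, Finset.filter_val, eq_comm]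
        rw [hcard]
        by_contra hlt
        push Not at hlt
        exact absurd ((Polynomial.lt_rootMultiplicity_iff_isRoot_iterate_derivative h0).2
          fun m hm => h i m (lt_of_le_of_lt hm hlt)) (lt_irrefl _)
      · push Not at hτ
        rw [Multiset.filter_eq_nil.2 fun a _ h => hτ a h.symm]
        simp
    have h1 := Multiset.card_le_card hle
    have h2 := P.card_roots'
    have h3 := (Polynomial.natDegree_lt_iff_degree_lt h0).2 hP
    simp at h1
    omega
  have hinj : Function.Injective L := by
    rw [← LinearMap.ker_eq_bot, LinearMap.ker_eq_bot']
    intro P hP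
    apply Subtype.ext
    refine hker P.1 (Polynomial.mem_degreeLT.1 P.2) fun i ℓ hℓ => ?_
    exact congrFun hP (⟨⟨y i, hmem i⟩, ⟨ℓ, hℓ⟩⟩ : I)
  have hdim : Module.finrank ℂ (Polynomial.degreeLT ℂ n) = Module.finrank ℂ (I → ℂ) := by
    rw [(Polynomial.degreeLTEquiv ℂ n).finrank_eq, Module.finrank_fintype_fun_eq_card,
      Module.finrank_fintype_fun_eq_card, Fintype.card_sigma, Fintype.card_fin]
    simp only [Fintype.card_fin]
    rw [Finset.sum_coe_sort (Finset.univ.image y) c, ← Finset.card_eq_sum_card_image]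
    simp
  have : FiniteDimensional ℂ (Polynomial.degreeLT ℂ n) :=
    (Polynomial.degreeLTEquiv ℂ n).symm.finiteDimensional
  obtain ⟨P, hP⟩ := (LinearMap.injective_iff_surjective_of_finrank_eq_finrank hdim).1 hinj
    fun p => iteratedDeriv (p.2 : ℕ) f p.1.1
  refine ⟨P.1, ⟨Polynomial.mem_degreeLT.1 P.2, fun i ℓ hℓ => ?_⟩, fun R hR => ?_⟩
  · exact congrFun hP (⟨⟨y i, hmem i⟩, ⟨ℓ, hℓ⟩⟩ : I)
  · refine sub_eq_zero.1 (hker (R - P.1) ?_ fun i ℓ hℓ => ?_)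
    · exact lt_of_le_of_lt (Polynomial.degree_sub_le _ _)
        (max_lt hR.1 (Polynomial.mem_degreeLT.1 P.2))
    · have h2 := congrFun hP (⟨⟨y i, hmem i⟩, ⟨ℓ, hℓ⟩⟩ : I)
      change (derivative^[ℓ] P.1).eval (y i) = iteratedDeriv ℓ f (y i) at h2
      rw [Polynomial.iterate_derivative_sub, Polynomial.eval_sub, hR.2 i ℓ hℓ, h2, sub_self]

/-- The Hermite interpolation polynomial. -/
def hermitePoly {n : ℕ} (y : Fin n → ℂ) (f : ℂ → ℂ) : ℂ[X] :=
  (existsUnique_isHermite y f).choose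

/-- The divided difference of order `n - 1` at `y_1, …, y_n`: the `n`-th coefficient in the Newton
form `∑_{j=1}^n c_j (x - y_1) ⋯ (x - y_{j-1})` of the Hermite interpolation polynomial. The `j`-th
Newton polynomial is monic of degree `j - 1`, so that `c_n` is the coefficient of `x^{n-1}`. -/
def dividedDifference {n : ℕ} (y : Fin n → ℂ) : (ℂ → ℂ) → ℂ :=
  fun f => (hermitePoly y f).coeff (n - 1)

/-- `Δ_Y(w)`, the divided difference at the nodes `x_i`, `i ∈ Y`, taken in increasing order. -/
def deltaSet {r : ℕ} (Y : Finset (Fin r)) (w : Fin r → ℂ) : (ℂ → ℂ) → ℂ :=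
  dividedDifference fun k : Fin Y.card => w (Y.orderEmbOfFin rfl k)

/-! ### Configurations -/

/-- A configuration: a partition of the index set into nonempty subsets `X_j`. -/
abbrev Configuration (r : ℕ) := Finpartition (Finset.univ : Finset (Fin r))

/-- The pairs `(j, ℓ)`: a member `X_j` of the partition and `ℓ ∈ {1, …, |X_j|}`, counted from `0`. -/
abbrev Configuration.Index {r : ℕ} (𝒞 : Configuration r) :=
  Σ Y : {Y : Finset (Fin r) // Y ∈ 𝒞.parts}, Fin Y.1.card

/-- `X_{j,ℓ}`: the first `ℓ` elements of `X_j`. -/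
def segment {r : ℕ} (𝒞 : Configuration r) (p : 𝒞.Index) : Finset (Fin r) :=
  p.1.1.filter fun i => i ≤ p.1.1.orderEmbOfFin rfl p.2

/-- The family `B_𝒞(w)` of the divided differences `Δ_{X_{j,ℓ}}(w)`. -/
def ddFamily {r : ℕ} (𝒞 : Configuration r) (w : Fin r → ℂ) : 𝒞.Index → ((ℂ → ℂ) → ℂ) :=
  fun p => deltaSet (segment 𝒞 p) w

/-- `w` is subordinated to `𝒞`: equal coordinates have their indices in the same subset. -/
def IsSubordinated {r : ℕ} (w : Fin r → ℂ) (𝒞 : Configuration r) : Prop :=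
  ∀ k l : Fin r, k ≠ l → w k = w l → ∃ Y ∈ 𝒞.parts, k ∈ Y ∧ l ∈ Y

/-! ### The output of the algorithm -/

/-- The signal `∑ β_{j,ℓ} Δ_{X_{j,ℓ}}(w)`. -/
def signalOf {r : ℕ} (𝒞 : Configuration r) (w : Fin r → ℂ) (b : 𝒞.Index → ℂ) : (ℂ → ℂ) → ℂ :=
  ∑ p, b p • ddFamily 𝒞 w p

/-- The linear system
`∑ β_{j,ℓ} Δ_{X_{j,ℓ}}(w)(x^k) = m_k`, `k = 0, …, 2r - 1`, for the coefficients. -/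
def SolvesSystem {r : ℕ} (𝒞 : Configuration r) (μ : Fin (2 * r) → ℂ) (w : Fin r → ℂ)
    (b : 𝒞.Index → ℂ) : Prop :=
  ∀ k : Fin (2 * r), ∑ p, b p * ddFamily 𝒞 w p (fun x => x ^ (k : ℕ)) = μ k

/-- The multivalued coefficient `β_{j,ℓ}` computed by the algorithm: its values at `μ` are the
`(j, ℓ)` coordinates of the solutions of the linear system at the values of `w(μ)`. -/
def coeffValues {r : ℕ} (𝒞 : Configuration r) (U : Set (Fin (2 * r) → ℂ)) (μ₁ : Fin (2 * r) → ℂ)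
    (w₁ : Fin r → ℂ) (p : 𝒞.Index) (μ : Fin (2 * r) → ℂ) : Set ℂ :=
  {y | ∃ w ∈ nodeValues U μ₁ w₁ μ, ∃ b, SolvesSystem 𝒞 μ w b ∧ b p = y}

/-! ### Multivalued functions -/

/-- `F` is a finitely-valued multivalued function on `U`, continuous in the sense of the Hausdorff
distance of the sets of values. -/
structure IsContinuousMultivaluedOn {A E : Type*} [TopologicalSpace A] [PseudoMetricSpace E]
    (F : A → Set E) (U : Set A) : Prop where
  nonempty : ∀ a ∈ U, (F a).Nonempty
  finite : ∀ a ∈ U, (F a).Finite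
  lower : ∀ a ∈ U, ∀ ε > 0, ∀ᶠ b in 𝓝[U] a, ∀ y ∈ F a, ∃ y' ∈ F b, dist y' y < ε
  upper : ∀ a ∈ U, ∀ ε > 0, ∀ᶠ b in 𝓝[U] a, ∀ y' ∈ F b, ∃ y ∈ F a, dist y' y < ε

/-- The values of `F` on `U` satisfy a polynomial equation `p(μ, y) = 0` with a nonzero polynomial
`p` in `μ` and `y`. -/
def IsAlgebraicMultivaluedOn {n : ℕ} (F : (Fin n → ℂ) → Set ℂ) (U : Set (Fin n → ℂ)) : Prop :=
  ∃ p : Polynomial (MvPolynomial (Fin n) ℂ), p ≠ 0 ∧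
    ∀ μ ∈ U, ∀ y ∈ F μ, (p.map (MvPolynomial.eval μ)).eval y = 0

end Prony

end

noncomputable section

namespace Prony

/-! ### The node polynomial -/

/-! A signal with nodes `w` acts on polynomials through their residues modulo `nodePoly w`, so it is
determined by its first `r` moments, and these can be prescribed freely (`momentEquiv`). Hence `μ`
is solvable with nodes `w` exactly when `nodePoly w` is orthogonal to all polynomials of degree `<
r` for the moment functional (`IsPronySolution.isDenom`, `IsDenom.isPronySolution`). If the `r × r`
Hankel determinant is nonzero, there is exactly one such monic polynomial of degree `r`, and it is
the Padé denominator (`IsPade.isDenom`, `IsDenom.isPade`). The nodes and the first `r` moments are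
therefore coordinates for `μ`, redundant only by permutations of the nodes.

The neighbourhood `U` is a `cell`, the image of a product of small balls in these coordinates; it is
open by continuity of roots. The radius `ε` is at most a third of the gap between distinct
coordinates of `w₀`, so an enumeration of the roots within `2ε` of `w₀` is already within `ε`.
Continuation thus never leaves the ball. Conversely every enumeration in the ball is reached,
because collisions can be bypassed in the complex domain. So the values of `w(μ)` are precisely the
enumerations of the roots close to `w₀` (`nodeValues_eq`).

All these enumerations are subordinated to the configuration. The Chinese remainder theorem across
blocks and Newton duality inside each block make the coefficient matrix invertible, also at
collisions, and its entries are polynomials in `w`. Inverting it gives continuity of the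
coefficients, compactness gives the bound, and Cramer's rule gives algebraicity. -/

theorem nodePoly_monic {n : ℕ} (w : Fin n → ℂ) : (nodePoly w).Monic :=
  monic_prod_of_monic _ _ fun i _ => monic_X_sub_C (w i)

theorem natDegree_nodePoly {n : ℕ} (w : Fin n → ℂ) : (nodePoly w).natDegree = n := by
  rw [nodePoly, natDegree_prod_of_monic _ _ fun i _ => monic_X_sub_C (w i)]
  simp

theorem degree_nodePoly {n : ℕ} (w : Fin n → ℂ) : (nodePoly w).degree = n := by
  rw [degree_eq_natDegree (nodePoly_monic w).ne_zero, natDegree_nodePoly]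

theorem roots_nodePoly {n : ℕ} (w : Fin n → ℂ) :
    (nodePoly w).roots = Finset.univ.val.map w := by
  have h := roots_multiset_prod_X_sub_C (Finset.univ.val.map w)
  rwa [Multiset.map_map] at h

theorem eval_nodePoly {n : ℕ} (w : Fin n → ℂ) (z : ℂ) :
    (nodePoly w).eval z = ∏ i, (z - w i) := by
  simp [nodePoly, eval_prod]

theorem eval_nodePoly_eq_zero_iff {n : ℕ} (w : Fin n → ℂ) (z : ℂ) :
    (nodePoly w).eval z = 0 ↔ z ∈ Set.range w := by
  rw [eval_nodePoly, Finset.prod_eq_zero_iff]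
  simp [sub_eq_zero, eq_comm]

theorem rootMultiplicity_nodePoly {n : ℕ} (w : Fin n → ℂ) (i : Fin n) :
    (nodePoly w).rootMultiplicity (w i) = mult w i := by
  rw [← count_roots, roots_nodePoly, Multiset.count_map]
  simp only [mult, Finset.card_def, Finset.filter_val, eq_comm]

theorem X_sub_C_pow_mult_dvd_nodePoly {n : ℕ} (w : Fin n → ℂ) (i : Fin n) :
    (X - C (w i)) ^ mult w i ∣ nodePoly w :=
  (le_rootMultiplicity_iff (nodePoly_monic w).ne_zero).1 (rootMultiplicity_nodePoly w i).ge

theorem nodePoly_comp_perm {n : ℕ} (w : Fin n → ℂ) (σ : Equiv.Perm (Fin n)) :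
    nodePoly (w ∘ σ) = nodePoly w :=
  Equiv.prod_comp σ fun i => X - C (w i)

/-- Equal root multisets mean equally large fibres over every value; bijections between the fibres
glue to a permutation. -/
theorem exists_perm_of_nodePoly_eq {n : ℕ} {w w' : Fin n → ℂ} (h : nodePoly w' = nodePoly w) :
    ∃ σ : Equiv.Perm (Fin n), w' = w ∘ σ := by
  classical
  have hr : Finset.univ.val.map w' = Finset.univ.val.map w := by
    rw [← roots_nodePoly, ← roots_nodePoly, h]
  have hc : ∀ c, Nonempty ({i // w' i = c} ≃ {i // w i = c}) := fun c => by
    have := congrArg (Multiset.count c) hr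
    rw [Multiset.count_map, Multiset.count_map] at this
    refine ⟨Fintype.equivOfCardEq ?_⟩
    rw [Fintype.card_subtype, Fintype.card_subtype]
    simpa only [Finset.card_def, Finset.filter_val, eq_comm] using this
  let e := fun c => (hc c).some
  exact ⟨Equiv.ofFiberEquiv e, funext fun i => (Equiv.ofFiberEquiv_map e i).symm⟩

theorem exists_nodePoly_eq {n : ℕ} {Q : ℂ[X]} (hQ : Q.Monic) (hn : Q.natDegree = n) :
    ∃ w : Fin n → ℂ, nodePoly w = Q := by
  have hs := IsAlgClosed.splits Q
  have hcard : Q.roots.toList.length = n := by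
    rw [Multiset.length_toList, ← hn]; exact hs.natDegree_eq_card_roots.symm
  refine ⟨fun i => Q.roots.toList.get (i.cast hcard.symm), ?_⟩
  subst hcard
  have h1 := hs.eq_prod_roots_of_monic hQ
  conv_rhs => rw [h1, ← Multiset.coe_toList Q.roots]
  rw [nodePoly, Multiset.map_coe, Multiset.prod_coe, ← List.prod_ofFn]
  congr 1
  apply List.ext_get <;> simp

/-! ### Hermite interpolation -/

theorem iteratedDeriv_eval (p : ℂ[X]) (ℓ : ℕ) :
    (iteratedDeriv ℓ fun x => p.eval x) = fun x => (derivative^[ℓ] p).eval x := by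
  induction ℓ with
  | zero => simp
  | succ ℓ ih =>
    rw [iteratedDeriv_succ, ih, Function.iterate_succ_apply']
    ext x
    exact Polynomial.deriv _

theorem hermitePoly_spec {n : ℕ} (y : Fin n → ℂ) (f : ℂ → ℂ) : IsHermite y f (hermitePoly y f) :=
  (existsUnique_isHermite y f).choose_spec.1

theorem hermitePoly_eq {n : ℕ} {y : Fin n → ℂ} {f : ℂ → ℂ} {P : ℂ[X]} (h : IsHermite y f P) :
    hermitePoly y f = P :=
  ((existsUnique_isHermite y f).choose_spec.2 P h).symm

theorem eval_iterate_derivative_eq_zero {n : ℕ} {w : Fin n → ℂ} {p : ℂ[X]} (h : nodePoly w ∣ p)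
    (i : Fin n) {ℓ : ℕ} (hℓ : ℓ < mult w i) : (derivative^[ℓ] p).eval (w i) = 0 := by
  rcases eq_or_ne p 0 with rfl | hp
  · simp
  · refine (lt_rootMultiplicity_iff_isRoot_iterate_derivative hp).1 ?_ ℓ le_rfl
    exact hℓ.trans_le ((le_rootMultiplicity_iff hp).2
      ((X_sub_C_pow_mult_dvd_nodePoly w i).trans h))

/-- Turns interpolation, and hence every divided difference, into division with remainder: multiples
of the node polynomial have vanishing jets at the nodes. -/
theorem hermitePoly_eval {n : ℕ} (w : Fin n → ℂ) (p : ℂ[X]) :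
    hermitePoly w (fun x => p.eval x) = p %ₘ nodePoly w := by
  refine hermitePoly_eq ⟨?_, fun i ℓ hℓ => ?_⟩
  · exact (degree_nodePoly w) ▸ degree_modByMonic_lt p (nodePoly_monic w)
  · rw [iteratedDeriv_eval]
    have h : p = p %ₘ nodePoly w + nodePoly w * (p /ₘ nodePoly w) :=
      (modByMonic_add_div p (nodePoly w)).symm
    conv_rhs => rw [h]
    rw [iterate_map_add]
    beta_reduce
    rw [eval_add, eval_iterate_derivative_eq_zero (dvd_mul_right _ _) i hℓ, add_zero]

theorem linearMap_eq_zero_of_degree_lt {E : Type*} [AddCommGroup E] [Module ℂ E]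
    {L : ℂ[X] →ₗ[ℂ] E} {n : ℕ} (h : ∀ k < n, L (X ^ k) = 0)
    {p : ℂ[X]} (hp : p.degree < n) : L p = 0 := by
  rw [p.as_sum_support_C_mul_X_pow, map_sum]
  refine Finset.sum_eq_zero fun k hk => ?_
  rw [← smul_eq_C_mul, map_smul, h k, smul_zero]
  exact_mod_cast (le_degree_of_mem_supp k hk).trans_lt hp

theorem linearMap_eq_of_degree_lt {E : Type*} [AddCommGroup E] [Module ℂ E]
    {L L' : ℂ[X] →ₗ[ℂ] E} {n : ℕ} (h : ∀ k < n, L (X ^ k) = L' (X ^ k))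
    {p : ℂ[X]} (hp : p.degree < n) : L p = L' p :=
  sub_eq_zero.1 <| linearMap_eq_zero_of_degree_lt (L := L - L')
    (fun k hk => sub_eq_zero.2 (h k hk)) hp

/-! ### Signals -/

/-- Two functions have the same jets at the nodes of `w`. -/
def SameJets {n : ℕ} (w : Fin n → ℂ) (f f' : ℂ → ℂ) : Prop :=
  ∀ (i : Fin n) (ℓ : ℕ), ℓ < mult w i → iteratedDeriv ℓ f (w i) = iteratedDeriv ℓ f' (w i)

theorem apply_eq_of_sameJets {n : ℕ} {w : Fin n → ℂ} {g : (ℂ → ℂ) → ℂ} (hg : g ∈ signalSpace w)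
    {f f' : ℂ → ℂ} (h : SameJets w f f') : g f = g f' := by
  induction hg using Submodule.span_induction with
  | mem g hg => obtain ⟨i, ℓ, hℓ, rfl⟩ := hg; exact h i ℓ hℓ
  | zero => rfl
  | add g g' _ _ h1 h2 => simp [h1, h2]
  | smul c g _ h1 => simp [h1]

/-- Together with `apply_eq_of_sameJets`, this reduces the study of signals on arbitrary functions
to polynomials of degree `< n`. -/
theorem sameJets_hermitePoly {n : ℕ} (w : Fin n → ℂ) (f : ℂ → ℂ) :
    SameJets w f fun x => (hermitePoly w f).eval x := fun i ℓ hℓ => by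
  rw [iteratedDeriv_eval]
  exact ((hermitePoly_spec w f).2 i ℓ hℓ).symm

/-- A signal acts linearly on polynomials and annihilates the multiples of the node polynomial. -/
theorem exists_linearMap_of_mem {n : ℕ} {w : Fin n → ℂ} {g : (ℂ → ℂ) → ℂ}
    (hg : g ∈ signalSpace w) : ∃ L : ℂ[X] →ₗ[ℂ] ℂ, (∀ p, L p = g fun x => p.eval x) ∧
      ∀ p, nodePoly w ∣ p → L p = 0 := by
  induction hg using Submodule.span_induction with
  | mem g hg =>
    obtain ⟨i, ℓ, hℓ, rfl⟩ := hg
    refine ⟨(leval (w i)).comp (derivative ^ ℓ), fun p => ?_, fun p hp => ?_⟩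
    · rw [deltaDeriv, iteratedDeriv_eval, LinearMap.comp_apply, Module.End.pow_apply]
      rfl
    · rw [LinearMap.comp_apply, Module.End.pow_apply]
      exact eval_iterate_derivative_eq_zero hp i hℓ
  | zero => exact ⟨0, by simp, by simp⟩
  | add g g' _ _ h1 h2 =>
    obtain ⟨L, hL, hL0⟩ := h1
    obtain ⟨L', hL', hL0'⟩ := h2
    exact ⟨L + L', by simp [hL, hL'], fun p hp => by simp [hL0 p hp, hL0' p hp]⟩
  | smul c g _ h1 =>
    obtain ⟨L, h1, h2⟩ := h1
    exact ⟨c • L, by simp [h1], fun p hp => by simp [h2 p hp]⟩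

/-- The signal `f ↦` the coefficient of `x^k` in the Hermite interpolation polynomial. -/
def hermiteCoeff {n : ℕ} (w : Fin n → ℂ) (k : ℕ) : (ℂ → ℂ) → ℂ :=
  fun f => (hermitePoly w f).coeff k

theorem hermiteCoeff_mem {n : ℕ} (w : Fin n → ℂ) (k : ℕ) : hermiteCoeff w k ∈ signalSpace w := by
  let J : (Σ i : Fin n, Fin (mult w i)) → degreeLT ℂ n →ₗ[ℂ] ℂ := fun p =>
    ((leval (w p.1)).comp (derivative ^ (p.2 : ℕ))).comp (degreeLT ℂ n).subtype
  have hJ : ∀ p P, J p P = (derivative^[(p.2 : ℕ)] P.1).eval (w p.1) := fun p P => by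
    simp only [J, LinearMap.comp_apply, Module.End.pow_apply]
    rfl
  let K : degreeLT ℂ n →ₗ[ℂ] ℂ := (lcoeff ℂ k).comp (degreeLT ℂ n).subtype
  -- Duality: a functional vanishing on the common kernel of finitely many others is in their span.
  -- That common kernel is zero by uniqueness of Hermite interpolation.
  have hker : ⨅ p, LinearMap.ker (J p) ≤ LinearMap.ker K := by
    intro P hP
    simp only [Submodule.mem_iInf, LinearMap.mem_ker, hJ] at hP
    have h1 : IsHermite w (fun x => (0 : ℂ[X]).eval x) P.1 :=
      ⟨mem_degreeLT.1 P.2, fun i ℓ hℓ => by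
        rw [iteratedDeriv_eval, hP ⟨i, ⟨ℓ, hℓ⟩⟩]; simp⟩
    have h2 := hermitePoly_eq h1
    rw [hermitePoly_eval, zero_modByMonic] at h2
    simp [K, ← h2]
  obtain ⟨c, hc⟩ := (Submodule.mem_span_range_iff_exists_fun ℂ).1 (mem_span_of_iInf_ker_le_ker hker)
  have : hermiteCoeff w k = ∑ p, c p • deltaDeriv (w p.1) p.2 := by
    ext f
    have h := congrArg (fun F => F ⟨hermitePoly w f, mem_degreeLT.2 (hermitePoly_spec w f).1⟩) hc
    simp only [LinearMap.sum_apply, LinearMap.smul_apply, hJ] at h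
    rw [Finset.sum_apply]
    refine Eq.trans h.symm (Finset.sum_congr rfl fun p _ => ?_)
    rw [(hermitePoly_spec w f).2 p.1 p.2 p.2.2]
    rfl
  rw [this]
  exact Submodule.sum_mem _ fun p _ => Submodule.smul_mem _ _
    (Submodule.subset_span ⟨p.1, p.2, p.2.2, rfl⟩)

theorem moment_hermiteCoeff {n : ℕ} (w : Fin n → ℂ) (j k : ℕ) :
    moment (hermiteCoeff w j) k = (X ^ k %ₘ nodePoly w).coeff j := by
  rw [← hermitePoly_eval]
  simp [moment, hermiteCoeff]

theorem signal_eq_zero {n : ℕ} {w : Fin n → ℂ} {g : (ℂ → ℂ) → ℂ} (hg : g ∈ signalSpace w)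
    (h : ∀ k < n, moment g k = 0) : g = 0 := by
  obtain ⟨L, h1, -⟩ := exists_linearMap_of_mem hg
  ext f
  rw [apply_eq_of_sameJets hg (sameJets_hermitePoly w f), ← h1]
  refine linearMap_eq_zero_of_degree_lt (n := n) (fun k hk => ?_) (hermitePoly_spec w f).1
  simpa [h1, moment] using h k hk

theorem signal_ext {n : ℕ} {w : Fin n → ℂ} {g g' : (ℂ → ℂ) → ℂ} (hg : g ∈ signalSpace w)
    (hg' : g' ∈ signalSpace w) (h : ∀ k < n, moment g k = moment g' k) : g = g' :=
  sub_eq_zero.1 <| signal_eq_zero (Submodule.sub_mem _ hg hg') fun k hk =>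
    sub_eq_zero.2 (h k hk)

/-- The signal with nodes `w` and initial moments `a`. -/
def signalWith {n : ℕ} (w a : Fin n → ℂ) : (ℂ → ℂ) → ℂ := ∑ j, a j • hermiteCoeff w j

theorem signalWith_mem {n : ℕ} (w a : Fin n → ℂ) : signalWith w a ∈ signalSpace w :=
  Submodule.sum_mem _ fun _ _ => Submodule.smul_mem _ _ (hermiteCoeff_mem w _)

theorem moment_signalWith {n : ℕ} (w a : Fin n → ℂ) (k : ℕ) :
    moment (signalWith w a) k = ∑ j : Fin n, a j * (X ^ k %ₘ nodePoly w).coeff j := by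
  simp_rw [← moment_hermiteCoeff]
  simp [moment, signalWith]

theorem moment_signalWith_of_lt {n : ℕ} (w a : Fin n → ℂ) (k : Fin n) :
    moment (signalWith w a) k = a k := by
  rw [moment_signalWith, (modByMonic_eq_self_iff (nodePoly_monic w)).2]
  · simp [coeff_X_pow, Fin.val_inj]
  · rw [degree_nodePoly, degree_X_pow]; exact_mod_cast k.2

/-- The initial moments are coordinates on the space of signals. -/
def momentEquiv {n : ℕ} (w : Fin n → ℂ) : signalSpace w ≃ₗ[ℂ] (Fin n → ℂ) :=
  LinearEquiv.ofBijective
    { toFun := fun g (k : Fin n) => moment g.1 k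
      map_add' := fun _ _ => rfl
      map_smul' := fun _ _ => rfl }
    ⟨fun g g' h => Subtype.ext <| signal_ext g.2 g'.2 fun k hk => congrFun h ⟨k, hk⟩,
      fun a => ⟨⟨_, signalWith_mem w a⟩, funext fun k => moment_signalWith_of_lt w a k⟩⟩

theorem finrank_signalSpace {n : ℕ} (w : Fin n → ℂ) : Module.finrank ℂ (signalSpace w) = n := by
  rw [(momentEquiv w).finrank_eq, Module.finrank_fin_fun]

theorem mult_comp_le {m n : ℕ} (w : Fin n → ℂ) {e : Fin m → Fin n} (he : Function.Injective e)
    (i : Fin m) : mult (w ∘ e) i ≤ mult w (e i) := by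
  refine Finset.card_le_card_of_injOn e (fun k hk => ?_) he.injOn
  simpa using hk

theorem signalSpace_comp_le {m n : ℕ} (w : Fin n → ℂ) {e : Fin m → Fin n}
    (he : Function.Injective e) : signalSpace (w ∘ e) ≤ signalSpace w := by
  refine Submodule.span_mono ?_
  rintro _ ⟨i, ℓ, hℓ, rfl⟩
  exact ⟨e i, ℓ, hℓ.trans_le (mult_comp_le w he i), rfl⟩

theorem signalSpace_congr {n : ℕ} {w w' : Fin n → ℂ} (h : nodePoly w' = nodePoly w) :
    signalSpace w' = signalSpace w := by
  apply le_antisymm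
  · obtain ⟨σ, rfl⟩ := exists_perm_of_nodePoly_eq h
    exact signalSpace_comp_le _ σ.injective
  · obtain ⟨σ, rfl⟩ := exists_perm_of_nodePoly_eq h.symm
    exact signalSpace_comp_le _ σ.injective

/-! ### Divided differences -/

theorem nodePoly_orderEmb {r : ℕ} (Y : Finset (Fin r)) (w : Fin r → ℂ) :
    nodePoly (fun k : Fin Y.card => w (Y.orderEmbOfFin rfl k)) = ∏ i ∈ Y, (X - C (w i)) := by
  conv_rhs => rw [← Finset.map_orderEmbOfFin_univ Y rfl, Finset.prod_map]
  rfl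

theorem deltaSet_eval {r : ℕ} (Y : Finset (Fin r)) (w : Fin r → ℂ) (p : ℂ[X]) :
    deltaSet Y w (fun x => p.eval x) =
      (p %ₘ ∏ i ∈ Y, (X - C (w i))).coeff (Y.card - 1) := by
  rw [deltaSet, dividedDifference, hermitePoly_eval, nodePoly_orderEmb]

theorem deltaSet_mem {r : ℕ} (Y : Finset (Fin r)) (w : Fin r → ℂ) :
    deltaSet Y w ∈ signalSpace w :=
  signalSpace_comp_le w (Y.orderEmbOfFin rfl).injective
    (hermiteCoeff_mem (w ∘ Y.orderEmbOfFin rfl) (Y.card - 1))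

/-- Since `ℓ` is counted from `0`, the divided difference on this segment reads off the coefficient
of degree `p.2`. -/
theorem card_segment {r : ℕ} (𝒞 : Configuration r) (p : 𝒞.Index) :
    (segment 𝒞 p).card = p.2 + 1 := by
  have : segment 𝒞 p = (Finset.Iic p.2).map (p.1.1.orderEmbOfFin rfl).toEmbedding := by
    ext i
    simp only [segment, Finset.mem_filter, Finset.mem_map, Finset.mem_Iic]
    constructor
    · rintro ⟨h1, h2⟩
      obtain ⟨k, rfl⟩ : i ∈ Set.range (p.1.1.orderEmbOfFin rfl) := by
        rw [Finset.range_orderEmbOfFin]; exact h1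
      exact ⟨k, by simpa using h2, rfl⟩
    · rintro ⟨k, hk, rfl⟩
      exact ⟨Finset.orderEmbOfFin_mem _ _ _, by simpa using hk⟩
  rw [this, Finset.card_map, Fin.card_Iic]

theorem segment_subset {r : ℕ} (𝒞 : Configuration r) (p : 𝒞.Index) : segment 𝒞 p ⊆ p.1.1 :=
  Finset.filter_subset _ _

theorem ddFamily_mem {r : ℕ} (𝒞 : Configuration r) (w : Fin r → ℂ) (p : 𝒞.Index) :
    ddFamily 𝒞 w p ∈ signalSpace w := deltaSet_mem _ w

theorem ddFamily_eval {r : ℕ} (𝒞 : Configuration r) (w : Fin r → ℂ) (p : 𝒞.Index) (f : ℂ[X]) :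
    ddFamily 𝒞 w p (fun x => f.eval x) =
      (f %ₘ ∏ i ∈ segment 𝒞 p, (X - C (w i))).coeff p.2 := by
  rw [ddFamily, deltaSet_eval, card_segment, Nat.add_sub_cancel]

/-- The Newton polynomials are dual to the divided differences of a single block. -/
theorem sum_ddFamily_newton {r : ℕ} (𝒞 : Configuration r) (w : Fin r → ℂ)
    (Y : {Y : Finset (Fin r) // Y ∈ 𝒞.parts}) (b : Fin Y.1.card → ℂ)
    (h : ∀ f : ℂ[X], ∑ ℓ, b ℓ * ddFamily 𝒞 w ⟨Y, ℓ⟩ (fun x => f.eval x) = 0) : b = 0 := by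
  ext ℓ
  -- The Newton polynomial with the `ℓ` nodes strictly before position `ℓ`.
  let N : ℂ[X] := ∏ i ∈ Y.1 with i < Y.1.orderEmbOfFin rfl ℓ, (X - C (w i))
  have hcard : (Y.1.filter fun i => i < Y.1.orderEmbOfFin rfl ℓ).card = ℓ := by
    have : (Y.1.filter fun i => i < Y.1.orderEmbOfFin rfl ℓ) =
        (Finset.Iio ℓ).map (Y.1.orderEmbOfFin rfl).toEmbedding := by
      ext i
      simp only [Finset.mem_filter, Finset.mem_map, Finset.mem_Iio]
      constructor
      · rintro ⟨h1, h2⟩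
        obtain ⟨k, rfl⟩ : i ∈ Set.range (Y.1.orderEmbOfFin rfl) := by
          rw [Finset.range_orderEmbOfFin]; exact h1
        exact ⟨k, by simpa using h2, rfl⟩
      · rintro ⟨k, hk, rfl⟩
        exact ⟨Finset.orderEmbOfFin_mem _ _ _, by simpa using hk⟩
    rw [this, Finset.card_map, Fin.card_Iio]
  have hmon : N.Monic := monic_prod_of_monic _ _ fun i _ => monic_X_sub_C (w i)
  have hdeg : N.natDegree = ℓ := by
    rw [natDegree_prod_of_monic _ _ fun i _ => monic_X_sub_C (w i)]
    simpa using hcard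
  have key : ∀ k, ddFamily 𝒞 w ⟨Y, k⟩ (fun x => N.eval x) = if k = ℓ then 1 else 0 := by
    intro k
    rw [ddFamily_eval]
    have hM : (∏ i ∈ segment 𝒞 ⟨Y, k⟩, (X - C (w i))).Monic :=
      monic_prod_of_monic _ _ fun i _ => monic_X_sub_C (w i)
    have hMd : (∏ i ∈ segment 𝒞 ⟨Y, k⟩, (X - C (w i))).natDegree = (k : ℕ) + 1 := by
      rw [natDegree_prod_of_monic _ _ fun i _ => monic_X_sub_C (w i)]
      simpa using card_segment 𝒞 ⟨Y, k⟩
    -- For `k < ℓ` the segment polynomial divides `N`. For `k ≥ ℓ` the degree of `N` is too small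
    -- for division to change it, and its coefficient of degree `k` is `1` or `0`.
    rcases lt_or_ge k ℓ with hk | hk
    · rw [if_neg hk.ne, (modByMonic_eq_zero_iff_dvd hM).2, coeff_zero]
      refine Finset.prod_dvd_prod_of_subset _ _ _ fun i hi => ?_
      simp only [segment, Finset.mem_filter] at hi ⊢
      exact ⟨hi.1, hi.2.trans_lt (by simpa using hk)⟩
    · have hk' : (ℓ : ℕ) ≤ k := hk
      rw [(modByMonic_eq_self_iff hM).2]
      · split_ifs with h0
        · subst h0
          change N.coeff (k : ℕ) = 1
          rw [← hdeg]; exact hmon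
        · apply coeff_eq_zero_of_natDegree_lt
          rw [hdeg]
          exact lt_of_le_of_ne hk' fun h => h0 (Fin.ext h.symm)
      · rw [degree_eq_natDegree hmon.ne_zero, degree_eq_natDegree hM.ne_zero, hdeg, hMd]
        exact_mod_cast Nat.lt_succ_of_le hk'
  simpa [key] using h N

/-- Divided differences at nodes of a block only depend on the residue modulo the block. -/
theorem ddFamily_eval_congr {r : ℕ} (𝒞 : Configuration r) (w : Fin r → ℂ) (p : 𝒞.Index)
    {f f' : ℂ[X]} (h : ∏ i ∈ p.1.1, (X - C (w i)) ∣ f - f') :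
    ddFamily 𝒞 w p (fun x => f.eval x) = ddFamily 𝒞 w p (fun x => f'.eval x) := by
  have hM : (∏ i ∈ segment 𝒞 p, (X - C (w i))).Monic :=
      monic_prod_of_monic _ _ fun i _ => monic_X_sub_C (w i)
  rw [ddFamily_eval, ddFamily_eval]
  congr 1
  rw [← sub_eq_zero, ← sub_modByMonic, modByMonic_eq_zero_iff_dvd hM]
  exact (Finset.prod_dvd_prod_of_subset _ _ _ (segment_subset 𝒞 p)).trans h

/-- Subordination makes the node products of different blocks coprime, so a relation can be
localised to one block, where Newton duality applies. -/
theorem linearIndependent_ddFamily {r : ℕ} {𝒞 : Configuration r} {w : Fin r → ℂ}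
    (hw : IsSubordinated w 𝒞) : LinearIndependent ℂ (ddFamily 𝒞 w) := by
  classical
  rw [Fintype.linearIndependent_iff]
  intro b hb
  suffices ∀ Y, (fun ℓ => b ⟨Y, ℓ⟩) = 0 from fun p => congrFun (this p.1) p.2
  intro Y
  refine sum_ddFamily_newton 𝒞 w Y _ fun f => ?_
  let G : ℂ[X] := ∏ i ∈ Y.1ᶜ, (X - C (w i))
  have hcop : IsCoprime G (∏ i ∈ Y.1, (X - C (w i))) := by
    refine IsCoprime.prod_left fun i hi => IsCoprime.prod_right fun k hk => ?_
    refine isCoprime_X_sub_C_of_isUnit_sub (sub_ne_zero.2 fun h => ?_).isUnit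
    have hik : i ≠ k := fun h => (Finset.mem_compl.1 hi) (h ▸ hk)
    obtain ⟨Z, hZ, h1, h2⟩ := hw i k hik h
    have hYZ : Y.1 = Z := 𝒞.eq_of_mem_parts Y.2 hZ hk h2
    exact Finset.mem_compl.1 hi (hYZ ▸ h1)
  obtain ⟨u, v, huv⟩ := hcop
  -- `u * G` is `1` modulo block `Y` and `0` modulo every other block, so this test function
  -- isolates the contribution of `Y` on `f`.
  have h := congrFun hb fun x => (u * G * f).eval x
  simp only [Finset.sum_apply, Pi.smul_apply, smul_eq_mul, Pi.zero_apply] at h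
  rw [Fintype.sum_sigma, Finset.sum_eq_single Y] at h
  · rw [← h]
    refine Finset.sum_congr rfl fun ℓ _ => ?_
    rw [ddFamily_eval_congr 𝒞 w ⟨Y, ℓ⟩ (f' := u * G * f)]
    refine ⟨v * f, ?_⟩
    linear_combination -f * huv
  · intro Z _ hZ
    refine Finset.sum_eq_zero fun ℓ _ => ?_
    rw [ddFamily_eval_congr 𝒞 w ⟨Z, ℓ⟩ (f' := 0), ddFamily_eval]
    · simp
    · have : ∏ i ∈ Z.1, (X - C (w i)) ∣ G := by
        refine Finset.prod_dvd_prod_of_subset _ _ _ fun i hi => Finset.mem_compl.2 fun hi' => ?_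
        exact hZ (Subtype.ext (𝒞.eq_of_mem_parts Z.2 Y.2 hi hi'))
      rw [sub_zero]
      exact (this.mul_left u).mul_right f
  · simp

theorem card_index {r : ℕ} (𝒞 : Configuration r) : Fintype.card 𝒞.Index = r := by
  rw [Fintype.card_sigma]
  simp only [Fintype.card_fin]
  rw [Finset.sum_coe_sort 𝒞.parts Finset.card, 𝒞.sum_card_parts]
  simp

theorem span_ddFamily {r : ℕ} {𝒞 : Configuration r} {w : Fin r → ℂ}
    (hw : IsSubordinated w 𝒞) : Submodule.span ℂ (Set.range (ddFamily 𝒞 w)) = signalSpace w := by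
  have : FiniteDimensional ℂ (signalSpace w) := (momentEquiv w).symm.finiteDimensional
  refine Submodule.eq_of_le_of_finrank_eq (Submodule.span_le.2 ?_) ?_
  · rintro _ ⟨p, rfl⟩
    exact ddFamily_mem 𝒞 w p
  · rw [finrank_span_eq_card (linearIndependent_ddFamily hw), finrank_signalSpace, card_index]

/-! ### The moment functional -/

/-- The functional `x^k ↦ m_k` for `k < 2 r`, and `x^k ↦ 0` for `k ≥ 2 r`. -/
def momentMap {r : ℕ} (μ : Fin (2 * r) → ℂ) : ℂ[X] →ₗ[ℂ] ℂ := ∑ k : Fin (2 * r), μ k • lcoeff ℂ k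

theorem momentMap_X_pow {r : ℕ} (μ : Fin (2 * r) → ℂ) (k : Fin (2 * r)) :
    momentMap μ (X ^ (k : ℕ)) = μ k := by
  simp [momentMap, LinearMap.sum_apply, coeff_X_pow, Fin.val_inj]

/-- The square Hankel matrix `(m_{i+j})`, `0 ≤ i, j < r`. -/
def squareHankel {r : ℕ} (μ : Fin (2 * r) → ℂ) : Matrix (Fin r) (Fin r) ℂ :=
  Matrix.of fun i j => μ ⟨i + j, by omega⟩

/-- The upper left `r × r` minor involves only the first `2r` moments, so it survives the
projection. -/
theorem det_squareHankel_ne_zero_of_mem {d r : ℕ} {h : r ≤ d} {μ : Fin (2 * r) → ℂ}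
    (hμ : μ ∈ stratumStar d r h) : (squareHankel μ).det ≠ 0 := by
  obtain ⟨ν, hν, rfl⟩ := hμ
  exact hν.2

theorem momentMap_X_pow_mul {r : ℕ} (μ : Fin (2 * r) → ℂ) (i : Fin r) {q : ℂ[X]}
    (hq : q.degree < r) :
    momentMap μ (X ^ (i : ℕ) * q) = (squareHankel μ).mulVec (fun j => q.coeff j) i := by
  refine linearMap_eq_of_degree_lt (L := momentMap μ ∘ₗ LinearMap.mulLeft ℂ (X ^ (i : ℕ)))
    (L' := ∑ j : Fin r, squareHankel μ i j • lcoeff ℂ j) (n := r) (fun k hk => ?_) hq |>.trans ?_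
  · have : X ^ (i : ℕ) * X ^ k = (X ^ ((⟨i + k, by omega⟩ : Fin (2 * r)) : ℕ) : ℂ[X]) := by
      rw [← pow_add]
    rw [LinearMap.comp_apply, LinearMap.mulLeft_apply, this, momentMap_X_pow, LinearMap.sum_apply,
      Finset.sum_eq_single ⟨k, hk⟩]
    · simp [squareHankel]
    · intro j _ hj
      have : (j : ℕ) ≠ k := fun h => hj (Fin.ext h)
      simp [coeff_X_pow, this]
    · simp
  · simp [Matrix.mulVec, dotProduct, LinearMap.sum_apply]

/-- Orthogonality to the polynomials of degree less than `r`. -/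
def IsOrthogonal {r : ℕ} (μ : Fin (2 * r) → ℂ) (q : ℂ[X]) : Prop :=
  ∀ i < r, momentMap μ (X ^ i * q) = 0

/-- Orthogonality says that the coefficient vector of `q` is in the kernel of the Hankel matrix. -/
theorem IsOrthogonal.eq_zero {r : ℕ} {μ : Fin (2 * r) → ℂ} (hμ : (squareHankel μ).det ≠ 0)
    {q : ℂ[X]} (h : IsOrthogonal μ q) (hq : q.degree < r) : q = 0 := by
  have h0 : (fun j : Fin r => q.coeff j) = 0 := by
    refine Matrix.eq_zero_of_mulVec_eq_zero hμ (funext fun i => ?_)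
    rw [← momentMap_X_pow_mul μ i hq]
    exact h i i.2
  ext k
  rcases lt_or_ge k r with hk | hk
  · exact congrFun h0 ⟨k, hk⟩
  · exact coeff_eq_zero_of_degree_lt (hq.trans_le (by exact_mod_cast hk))

/-- `Q` is a denominator of degree `r` for the Padé problem with data `μ`. -/
structure IsDenom {r : ℕ} (μ : Fin (2 * r) → ℂ) (Q : ℂ[X]) : Prop where
  monic : Q.Monic
  natDegree_eq : Q.natDegree = r
  orthogonal : IsOrthogonal μ Q

theorem IsDenom.degree_eq {r : ℕ} {μ : Fin (2 * r) → ℂ} {Q : ℂ[X]} (h : IsDenom μ Q) :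
    Q.degree = r := by
  rw [degree_eq_natDegree h.monic.ne_zero, h.natDegree_eq]

theorem IsDenom.unique {r : ℕ} {μ : Fin (2 * r) → ℂ} (hμ : (squareHankel μ).det ≠ 0)
    {Q Q' : ℂ[X]} (h : IsDenom μ Q) (h' : IsDenom μ Q') : Q = Q' := by
  rw [← sub_eq_zero]
  refine IsOrthogonal.eq_zero hμ (fun i hi => ?_) ?_
  · rw [mul_sub, map_sub, h.orthogonal i hi, h'.orthogonal i hi, sub_zero]
  · rw [← h.degree_eq]
    refine degree_sub_lt_left (h.degree_eq.trans h'.degree_eq.symm) h.monic.ne_zero ?_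
    rw [h.monic, h'.monic]

/-- The denominator of the Padé approximant, obtained by solving the Hankel system. -/
def hankelDenom {r : ℕ} (μ : Fin (2 * r) → ℂ) : ℂ[X] :=
  X ^ r - ∑ j : Fin r, C (((squareHankel μ)⁻¹.mulVec fun i => μ ⟨i + r, by omega⟩) j) * X ^ (j : ℕ)

theorem degree_sum_fin_C_mul_X_pow_lt {r : ℕ} (c : Fin r → ℂ) :
    degree (∑ j : Fin r, C (c j) * X ^ (j : ℕ)) < (r : WithBot ℕ) := by
  rw [← mem_degreeLT]
  refine Submodule.sum_mem _ fun j _ => mem_degreeLT.2 ?_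
  exact (degree_C_mul_X_pow_le _ _).trans_lt (by exact_mod_cast j.2)

/-- Orthogonality to `X ^ i` is row `i` of the Hankel system that defines the lower coefficients. -/
theorem isDenom_hankelDenom {r : ℕ} {μ : Fin (2 * r) → ℂ} (hμ : (squareHankel μ).det ≠ 0) :
    IsDenom μ (hankelDenom μ) := by
  set c := (squareHankel μ)⁻¹.mulVec fun i => μ ⟨i + r, by omega⟩ with hc
  have hlt := degree_sum_fin_C_mul_X_pow_lt c
  have hdeg : (hankelDenom μ).degree = r := by
    rw [hankelDenom, degree_sub_eq_left_of_degree_lt (by rwa [degree_X_pow]), degree_X_pow]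
  refine ⟨monic_X_pow_sub hlt, natDegree_eq_of_degree_eq_some hdeg, fun i hi => ?_⟩
  rw [hankelDenom, mul_sub, map_sub, ← hc, momentMap_X_pow_mul μ ⟨i, hi⟩ hlt]
  have h1 : (fun j : Fin r => (∑ j : Fin r, C (c j) * X ^ (j : ℕ)).coeff j) = c := by
    ext j
    simp [finsetSum_coeff, coeff_X_pow, Fin.val_inj]
  have h2 : X ^ i * X ^ r = (X ^ ((⟨i + r, by omega⟩ : Fin (2 * r)) : ℕ) : ℂ[X]) := by
    rw [← pow_add]
  rw [h1, h2, momentMap_X_pow, hc, Matrix.mulVec_mulVec, Matrix.mul_nonsing_inv _ hμ.isUnit,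
    Matrix.one_mulVec, sub_self]

/-! ### The Padé problem as a polynomial congruence -/

/-- The polynomial `∑ m_k x^{2r-1-k}`. -/
def reversedMoments {r : ℕ} (μ : Fin (2 * r) → ℂ) : ℂ[X] :=
  ∑ k : Fin (2 * r), C (μ k) * X ^ (2 * r - 1 - k)

theorem coeff_reversedMoments {r : ℕ} (μ : Fin (2 * r) → ℂ) (k : Fin (2 * r)) :
    (reversedMoments μ).coeff (2 * r - 1 - k) = μ k := by
  rw [reversedMoments, finsetSum_coeff, Finset.sum_eq_single k]
  · simp
  · intro j _ hj
    have : 2 * r - 1 - (k : ℕ) ≠ 2 * r - 1 - j := fun h => hj (Fin.ext (by omega))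
    rw [coeff_C_mul_X_pow, if_neg this]
  · simp

/-- Orthogonality of `Q` thus becomes the vanishing of the coefficients of degrees `r, …, 2r - 1` in
a polynomial product, the form in which it meets the Padé condition. -/
theorem coeff_mul_reversedMoments {r : ℕ} (μ : Fin (2 * r) → ℂ) {Q : ℂ[X]}
    (hQ : Q.degree < (r + 1 : ℕ)) {i : ℕ} (hi : i < r) :
    (Q * reversedMoments μ).coeff (2 * r - 1 - i) = momentMap μ (X ^ i * Q) := by
  refine linearMap_eq_of_degree_lt
    (L := lcoeff ℂ (2 * r - 1 - i) ∘ₗ LinearMap.mulRight ℂ (reversedMoments μ))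
    (L' := momentMap μ ∘ₗ LinearMap.mulLeft ℂ (X ^ i)) (fun k hk => ?_) hQ
  have h2 : X ^ i * X ^ k = (X ^ ((⟨i + k, by omega⟩ : Fin (2 * r)) : ℕ) : ℂ[X]) := by
    rw [← pow_add]
  simp only [LinearMap.comp_apply, LinearMap.mulRight_apply, LinearMap.mulLeft_apply, lcoeff_apply]
  rw [h2, momentMap_X_pow, coeff_X_pow_mul', if_pos (by omega),
    ← coeff_reversedMoments μ ⟨i + k, by omega⟩]
  congr 1
  simp only
  omega

theorem eval_reversedMoments {r : ℕ} (μ : Fin (2 * r) → ℂ) {z : ℂ} (hz : z ≠ 0) :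
    (reversedMoments μ).eval z = z ^ (2 * r) * ∑ k : Fin (2 * r), μ k / z ^ (k.1 + 1) := by
  rw [reversedMoments, eval_finsetSum, Finset.mul_sum]
  refine Finset.sum_congr rfl fun k _ => ?_
  have : z ^ (2 * r) = z ^ (2 * r - 1 - k) * z ^ (k.1 + 1) := by
    rw [← pow_add]; congr 1; omega
  rw [this]
  simp
  field_simp

/-- Multiplied by `Q(z) z^(2r+1)`, the approximation error becomes the polynomial `X * N`, and
growth of polynomials at infinity is compared by degrees. The extra factor `X` turns `deg (X * N) ≤
deg Q` into the strict inequality for `N`. -/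
theorem pade_taylor_iff {r : ℕ} (μ : Fin (2 * r) → ℂ) {P Q : ℂ[X]} (hQ : Q ≠ 0) :
    ((fun z : ℂ => P.eval z / Q.eval z - ∑ k : Fin (2 * r), μ k / z ^ (k.1 + 1))
      =O[Bornology.cobounded ℂ] fun z : ℂ => (z ^ (2 * r + 1))⁻¹) ↔
    (P * X ^ (2 * r) - Q * reversedMoments μ).degree < Q.degree := by
  set N := P * X ^ (2 * r) - Q * reversedMoments μ with hN
  set f := fun z : ℂ => P.eval z / Q.eval z - ∑ k : Fin (2 * r), μ k / z ^ (k.1 + 1) with hf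
  have hne : ∀ᶠ z in Bornology.cobounded ℂ, z ≠ 0 ∧ Q.eval z ≠ 0 := by
    have h1 := (eventually_cofinite_not_isRoot (P := X * Q) (mul_ne_zero X_ne_zero hQ)).filter_mono
      (Bornology.le_cofinite ℂ)
    filter_upwards [h1] with z hz
    simpa [IsRoot] using hz
  have h1 : ∀ᶠ z in Bornology.cobounded ℂ,
      (X * N).eval z = f z * (Q.eval z * z ^ (2 * r + 1)) := by
    filter_upwards [hne] with z ⟨hz, hz'⟩
    simp only [hN, hf, eval_mul, eval_sub, eval_X, eval_pow, eval_reversedMoments μ hz]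
    field_simp
    ring
  have h2 : ∀ᶠ z in Bornology.cobounded ℂ,
      Q.eval z = (z ^ (2 * r + 1))⁻¹ * (Q.eval z * z ^ (2 * r + 1)) := by
    filter_upwards [hne] with z ⟨hz, hz'⟩
    field_simp
  have key : (f =O[Bornology.cobounded ℂ] fun z : ℂ => (z ^ (2 * r + 1))⁻¹) ↔
      (X * N).eval =O[Bornology.cobounded ℂ] Q.eval := by
    constructor
    · intro h
      exact (h.mul (Asymptotics.isBigO_refl (fun z => Q.eval z * z ^ (2 * r + 1)) _)).congr'
        (h1.mono fun _ => Eq.symm) (h2.mono fun _ => Eq.symm)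
    · intro h
      refine (h.mul (Asymptotics.isBigO_refl (fun z => (Q.eval z * z ^ (2 * r + 1))⁻¹) _)).congr'
        ?_ ?_
      · filter_upwards [h1, hne] with z h ⟨hz, hz'⟩
        rw [h]; field_simp
      · filter_upwards [hne] with z ⟨hz, hz'⟩
        field_simp
  rw [key]
  constructor
  · intro h
    by_contra! hlt
    have hN0 : N ≠ 0 := fun h0 => hQ (by simpa [h0] using hlt)
    have hlt' : Q.degree < (X * N).degree := by
      rw [mul_comm, degree_mul_X]
      exact hlt.trans_lt (by
        rw [degree_eq_natDegree hN0]; exact_mod_cast Nat.lt_succ_self _)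
    have h3 := h.trans_isLittleO (isLittleO_cobounded_of_degree_lt hlt')
    refine Asymptotics.isLittleO_irrefl' ?_ h3
    refine Eventually.frequently ?_
    filter_upwards [(eventually_cofinite_not_isRoot (P := X * N)
      (mul_ne_zero X_ne_zero hN0)).filter_mono (Bornology.le_cofinite ℂ)] with z hz
    exact norm_ne_zero_iff.2 hz
  · intro h
    refine isBigO_cobounded_of_degree_le ?_
    rw [mul_comm, degree_mul_X]
    exact Nat.WithBot.add_one_le_of_lt h

/-- The degrees `2r - 1 - i` with `i < r` are at least `r`, hence at least `deg Q`, and below `2r`,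
where `P * X ^ (2r)` contributes nothing. -/
theorem isOrthogonal_of_degree_lt {r : ℕ} {μ : Fin (2 * r) → ℂ} {P Q : ℂ[X]}
    (hQ : Q.natDegree ≤ r) (h : (P * X ^ (2 * r) - Q * reversedMoments μ).degree < Q.degree) :
    IsOrthogonal μ Q := by
  intro i hi
  have hQ' : Q.degree ≤ r := natDegree_le_iff_degree_le.1 hQ
  rw [← coeff_mul_reversedMoments μ (hQ'.trans_lt (by exact_mod_cast Nat.lt_succ_self r)) hi]
  have h1 : (P * X ^ (2 * r) - Q * reversedMoments μ).coeff (2 * r - 1 - i) = 0 :=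
    coeff_eq_zero_of_degree_lt (h.trans_le (hQ'.trans (by exact_mod_cast (by omega))))
  rw [coeff_sub, coeff_mul_X_pow', if_neg (by omega), zero_sub, neg_eq_zero] at h1
  exact h1

theorem IsPade.isDenom {r : ℕ} {μ : Fin (2 * r) → ℂ} (hμ : (squareHankel μ).det ≠ 0)
    {P Q : ℂ[X]} (h : IsPade μ P Q) : IsDenom μ Q := by
  have ho := isOrthogonal_of_degree_lt h.natDegree_le
    ((pade_taylor_iff μ h.monic.ne_zero).1 h.taylor)
  refine ⟨h.monic, le_antisymm h.natDegree_le ?_, ho⟩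
  by_contra! hlt
  exact h.monic.ne_zero (ho.eq_zero hμ ((natDegree_lt_iff_degree_lt h.monic.ne_zero).1 hlt))

/-! ### The numerator -/

/-- The divided difference `(Q(x) - Q(z)) / (x - z)` of a polynomial, as a polynomial in `x`. -/
def polyDiff (z : ℂ) : ℂ[X] →ₗ[ℂ] ℂ[X] :=
  (basisMonomials ℂ).constr ℂ fun j => ∑ b ∈ Finset.range j, X ^ b * C z ^ (j - 1 - b)

theorem polyDiff_X_pow (z : ℂ) (j : ℕ) :
    polyDiff z (X ^ j) = ∑ b ∈ Finset.range j, X ^ b * C z ^ (j - 1 - b) := by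
  have := (basisMonomials ℂ).constr_basis ℂ
    (fun j => ∑ b ∈ Finset.range j, (X : ℂ[X]) ^ b * C z ^ (j - 1 - b)) j
  rw [coe_basisMonomials] at this
  simp only [← X_pow_eq_monomial] at this
  exact this

/-- The polynomial `L((Q(x) - Q(z)) / (x - z))` of `z`, where `L` acts on the variable `x`. -/
def numerator (L : ℂ[X] →ₗ[ℂ] ℂ) : ℂ[X] →ₗ[ℂ] ℂ[X] :=
  (basisMonomials ℂ).constr ℂ fun j => ∑ b ∈ Finset.range j, C (L (X ^ b)) * X ^ (j - 1 - b)

theorem numerator_X_pow (L : ℂ[X] →ₗ[ℂ] ℂ) (j : ℕ) :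
    numerator L (X ^ j) = ∑ b ∈ Finset.range j, C (L (X ^ b)) * X ^ (j - 1 - b) := by
  have := (basisMonomials ℂ).constr_basis ℂ
    (fun j => ∑ b ∈ Finset.range j, C (L (X ^ b)) * (X : ℂ[X]) ^ (j - 1 - b)) j
  rw [coe_basisMonomials] at this
  simp only [← X_pow_eq_monomial] at this
  exact this

theorem linearMap_ext_X_pow {E : Type*} [AddCommGroup E] [Module ℂ E]
    {L L' : ℂ[X] →ₗ[ℂ] E} (h : ∀ k, L (X ^ k) = L' (X ^ k)) (p : ℂ[X]) : L p = L' p :=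
  linearMap_eq_of_degree_lt (n := p.natDegree + 1) (fun k _ => h k)
    (degree_le_natDegree.trans_lt (by exact_mod_cast Nat.lt_succ_self _))

theorem polyDiff_mul (z : ℂ) (Q : ℂ[X]) : polyDiff z Q * (X - C z) = Q - C (Q.eval z) := by
  have h : (LinearMap.mulRight ℂ (X - C z) ∘ₗ polyDiff z) Q =
      (LinearMap.id - monomial 0 ∘ₗ leval z : ℂ[X] →ₗ[ℂ] ℂ[X]) Q := by
    refine linearMap_ext_X_pow (fun k => ?_) Q
    rw [LinearMap.comp_apply, LinearMap.mulRight_apply, polyDiff_X_pow,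
      Commute.geom_sum₂_mul (Commute.all _ _)]
    simp [leval, monomial_zero_left]
  exact h

theorem eval_numerator (L : ℂ[X] →ₗ[ℂ] ℂ) (z : ℂ) (Q : ℂ[X]) :
    (numerator L Q).eval z = L (polyDiff z Q) := by
  refine linearMap_ext_X_pow (L := leval z ∘ₗ numerator L) (L' := L ∘ₗ polyDiff z) (fun k => ?_) Q
  simp only [LinearMap.comp_apply, numerator_X_pow, polyDiff_X_pow, map_sum]
  refine Finset.sum_congr rfl fun b _ => ?_
  have hR : L (X ^ b * C z ^ (k - 1 - b)) = z ^ (k - 1 - b) * L (X ^ b) := by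
    rw [← C_pow, mul_comm, ← smul_eq_C_mul, map_smul, smul_eq_mul]
  change eval z (C _ * X ^ _) = _
  rw [hR, eval_mul, eval_C, eval_pow, eval_X, mul_comm]

theorem degree_polyDiff_lt (z : ℂ) {Q : ℂ[X]} {r : ℕ} (hQ : Q.degree < (r + 1 : ℕ)) :
    (polyDiff z Q).degree < r := by
  rw [← mem_degreeLT, ← Submodule.Quotient.mk_eq_zero]
  refine linearMap_eq_zero_of_degree_lt (L := (degreeLT ℂ r).mkQ ∘ₗ polyDiff z) (fun k hk => ?_) hQ
  rw [LinearMap.comp_apply, Submodule.mkQ_apply, Submodule.Quotient.mk_eq_zero, polyDiff_X_pow]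
  refine Submodule.sum_mem _ fun b hb => mem_degreeLT.2 ?_
  rw [← C_pow, mul_comm]
  have := Finset.mem_range.1 hb
  exact (degree_C_mul_X_pow_le _ _).trans_lt (by exact_mod_cast (by omega))

theorem degree_numerator_lt (L : ℂ[X] →ₗ[ℂ] ℂ) {Q : ℂ[X]} {r : ℕ} (hQ : Q.degree < (r + 1 : ℕ)) :
    (numerator L Q).degree < r := by
  rw [← mem_degreeLT, ← Submodule.Quotient.mk_eq_zero]
  refine linearMap_eq_zero_of_degree_lt (L := (degreeLT ℂ r).mkQ ∘ₗ numerator L)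
    (fun k hk => ?_) hQ
  rw [LinearMap.comp_apply, Submodule.mkQ_apply, Submodule.Quotient.mk_eq_zero, numerator_X_pow]
  refine Submodule.sum_mem _ fun b hb => mem_degreeLT.2 ?_
  have := Finset.mem_range.1 hb
  exact (degree_C_mul_X_pow_le _ _).trans_lt (by exact_mod_cast (by omega))

theorem degree_numerator_mul_sub_lt {r : ℕ} (μ : Fin (2 * r) → ℂ) {Q : ℂ[X]}
    (hQ : Q.degree < (r + 1 : ℕ)) :
    degree (numerator (momentMap μ) Q * X ^ (2 * r) - Q * reversedMoments μ) <
      ((2 * r : ℕ) : WithBot ℕ) := by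
  rw [← mem_degreeLT, ← Submodule.Quotient.mk_eq_zero]
  refine linearMap_eq_zero_of_degree_lt (L := (degreeLT ℂ (2 * r)).mkQ ∘ₗ
    (LinearMap.mulRight ℂ (X ^ (2 * r)) ∘ₗ numerator (momentMap μ) -
      LinearMap.mulRight ℂ (reversedMoments μ))) (fun k hk => ?_) hQ
  simp only [LinearMap.comp_apply, Submodule.mkQ_apply, LinearMap.sub_apply,
    LinearMap.mulRight_apply, Submodule.Quotient.mk_eq_zero, numerator_X_pow]
  have hS : X ^ k * reversedMoments μ =
      ∑ b ∈ Finset.range (2 * r), C (momentMap μ (X ^ b)) * X ^ (k + (2 * r - 1 - b)) := by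
    rw [← Fin.sum_univ_eq_sum_range fun b =>
      C (momentMap μ (X ^ b)) * X ^ (k + (2 * r - 1 - b)), reversedMoments, Finset.mul_sum]
    refine Finset.sum_congr rfl fun b _ => ?_
    rw [momentMap_X_pow, pow_add]
    ring
  have hT : (∑ b ∈ Finset.range k, C (momentMap μ (X ^ b)) * X ^ (k - 1 - b)) * X ^ (2 * r) =
      ∑ b ∈ Finset.range k, C (momentMap μ (X ^ b)) * X ^ (k + (2 * r - 1 - b)) := by
    rw [Finset.sum_mul]
    refine Finset.sum_congr rfl fun b hb => ?_
    have := Finset.mem_range.1 hb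
    rw [mul_assoc, ← pow_add]
    congr 2
    omega
  -- The numerator is the polynomial part of `Q` times the moment series: the terms `b < k` cancel,
  -- and those with `b ≥ k` have exponent `k + (2r - 1 - b) < 2r`.
  rw [hS, hT, ← Finset.sum_range_add_sum_Ico _ (show k ≤ 2 * r by omega), sub_add_cancel_left,
    neg_mem_iff]
  refine Submodule.sum_mem _ fun b hb => mem_degreeLT.2 ?_
  have := Finset.mem_Ico.1 hb
  exact (degree_C_mul_X_pow_le _ _).trans_lt (by exact_mod_cast (by omega))

theorem IsDenom.isPade {r : ℕ} {μ : Fin (2 * r) → ℂ} (hμ : (squareHankel μ).det ≠ 0)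
    {Q : ℂ[X]} (h : IsDenom μ Q) : IsPade μ (numerator (momentMap μ) Q) Q := by
  have hQ : Q.degree < (r + 1 : ℕ) := by
    rw [h.degree_eq]; exact_mod_cast Nat.lt_succ_self r
  set P := numerator (momentMap μ) Q with hP
  have hN : (P * X ^ (2 * r) - Q * reversedMoments μ).degree < Q.degree := by
    rw [h.degree_eq, degree_lt_iff_coeff_zero]
    intro m hm
    -- Degrees from `r` to `2r - 1` vanish by orthogonality, those from `2r` on by the choice of the
    -- numerator.
    rcases lt_or_ge m (2 * r) with hm' | hm'
    · obtain ⟨i, hi, rfl⟩ : ∃ i < r, m = 2 * r - 1 - i := ⟨2 * r - 1 - m, by omega, by omega⟩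
      rw [coeff_sub, coeff_mul_reversedMoments μ hQ hi, h.orthogonal i hi, coeff_mul_X_pow',
        if_neg (by omega), sub_zero]
    · exact coeff_eq_zero_of_degree_lt
        ((degree_numerator_mul_sub_lt μ hQ).trans_le (by exact_mod_cast hm'))
  refine ⟨h.monic, h.degree_eq ▸ degree_numerator_lt _ hQ, h.natDegree_eq.le, ?_,
    (pade_taylor_iff μ h.monic.ne_zero).2 hN⟩
  -- Cancelling a common factor would leave a nonzero orthogonal polynomial of degree `< r`, against
  -- nondegeneracy.
  refine isCoprime_of_irreducible_dvd (fun h0 => h.monic.ne_zero h0.2) ?_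
  rintro D hD ⟨P', hP'⟩ ⟨Q', hQ'⟩
  have hQ0 : Q' ≠ 0 := fun h0 => h.monic.ne_zero (by rw [hQ', h0, mul_zero])
  have hdeg : Q.natDegree = D.natDegree + Q'.natDegree := by
    rw [hQ', natDegree_mul hD.ne_zero hQ0]
  have hDpos : 0 < D.natDegree := hD.natDegree_pos
  have h1 : (P' * X ^ (2 * r) - Q' * reversedMoments μ).degree < Q'.degree := by
    have h2 : P * X ^ (2 * r) - Q * reversedMoments μ =
        D * (P' * X ^ (2 * r) - Q' * reversedMoments μ) := by rw [hP', hQ']; ring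
    rw [h2, hQ', degree_mul, degree_mul] at hN
    exact lt_of_add_lt_add_left hN
  have hlt : Q'.natDegree < r := by have := h.natDegree_eq; omega
  exact hQ0 ((isOrthogonal_of_degree_lt hlt.le h1).eq_zero hμ
    ((natDegree_lt_iff_degree_lt hQ0).1 hlt))

theorem IsPade.unique {r : ℕ} {μ : Fin (2 * r) → ℂ} (hμ : (squareHankel μ).det ≠ 0)
    {P Q P' Q' : ℂ[X]} (h : IsPade μ P Q) (h' : IsPade μ P' Q') : P = P' ∧ Q = Q' := by
  obtain rfl := (h.isDenom hμ).unique hμ (h'.isDenom hμ)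
  refine ⟨?_, rfl⟩
  have h1 := (pade_taylor_iff μ h.monic.ne_zero).1 h.taylor
  have h2 := (pade_taylor_iff μ h.monic.ne_zero).1 h'.taylor
  have h3 := (degree_sub_le _ _).trans_lt (max_lt h1 h2)
  rw [sub_sub_sub_cancel_right, ← sub_mul, (h.isDenom hμ).degree_eq] at h3
  by_contra hne
  rw [degree_mul, degree_X_pow, degree_eq_natDegree (sub_ne_zero.2 hne)] at h3
  have : (P - P').natDegree + 2 * r < r := by exact_mod_cast h3
  omega

theorem existsUnique_isPade {r : ℕ} {μ : Fin (2 * r) → ℂ} (hμ : (squareHankel μ).det ≠ 0) :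
    ∃! R : ℂ[X] × ℂ[X], IsPade μ R.1 R.2 :=
  ⟨(_, _), (isDenom_hankelDenom hμ).isPade hμ, fun _ h =>
    Prod.ext_iff.2 (h.unique hμ ((isDenom_hankelDenom hμ).isPade hμ))⟩

theorem isPoleVector_iff {r : ℕ} {μ : Fin (2 * r) → ℂ} (hμ : (squareHankel μ).det ≠ 0)
    {w : Fin r → ℂ} : IsPoleVector μ w ↔ IsDenom μ (nodePoly w) :=
  ⟨fun ⟨_, h⟩ => h.isDenom hμ, fun h => ⟨_, h.isPade hμ⟩⟩

/-! ### Padé denominators and signals -/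

theorem IsPronySolution.apply_eval {r : ℕ} {μ : Fin (2 * r) → ℂ} {w : Fin r → ℂ}
    {g : (ℂ → ℂ) → ℂ} (h : IsPronySolution μ w g) {p : ℂ[X]} (hp : p.degree < (2 * r : ℕ)) :
    (g fun x => p.eval x) = momentMap μ p := by
  obtain ⟨L, hL, -⟩ := exists_linearMap_of_mem h.1
  rw [← hL]
  refine linearMap_eq_of_degree_lt (fun k hk => ?_) hp
  have := h.2 ⟨k, hk⟩
  rw [momentMap_X_pow μ ⟨k, hk⟩, ← this, hL]
  simp [moment]

/-- The signal annihilates multiples of its node polynomial, and `X ^ i * nodePoly w` with `i < r`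
has degree below `2r`, where signal and moment functional agree. -/
theorem IsPronySolution.isDenom {r : ℕ} {μ : Fin (2 * r) → ℂ} {w : Fin r → ℂ}
    {g : (ℂ → ℂ) → ℂ} (h : IsPronySolution μ w g) : IsDenom μ (nodePoly w) := by
  refine ⟨nodePoly_monic w, natDegree_nodePoly w, fun i hi => ?_⟩
  rw [← h.apply_eval]
  · obtain ⟨L, hL, hL0⟩ := exists_linearMap_of_mem h.1
    rw [← hL, hL0 _ (dvd_mul_left _ _)]
  · rw [degree_mul, degree_X_pow, degree_nodePoly]
    exact_mod_cast (by omega)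

/-- The first `r` moments. -/
def initialMoments {r : ℕ} (μ : Fin (2 * r) → ℂ) : Fin r → ℂ := fun k => μ ⟨k, by omega⟩

/-- The signal and the moment functional agree on the first `r` powers and both kill `X ^ i *
nodePoly w`; this gives the same linear recursion for the remaining moments. -/
theorem IsDenom.isPronySolution {r : ℕ} {μ : Fin (2 * r) → ℂ} {w : Fin r → ℂ}
    (h : IsDenom μ (nodePoly w)) : IsPronySolution μ w (signalWith w (initialMoments μ)) := by
  refine ⟨signalWith_mem _ _, ?_⟩
  obtain ⟨L, hL, hL0⟩ := exists_linearMap_of_mem (signalWith_mem w (initialMoments μ))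
  have hm : ∀ k, moment (signalWith w (initialMoments μ)) k = L (X ^ k) := fun k => by
    rw [hL]; simp [moment]
  suffices ∀ k (hk : k < 2 * r), L (X ^ k) = momentMap μ (X ^ k) from fun k => by
    rw [hm, this k k.2, momentMap_X_pow]
  intro k
  induction k using Nat.strong_induction_on with
  | _ k ih =>
    intro hk
    rcases lt_or_ge k r with hkr | hkr
    · rw [← hm, moment_signalWith_of_lt w _ ⟨k, hkr⟩, momentMap_X_pow μ ⟨k, hk⟩]
      rfl
    · obtain ⟨i, rfl⟩ := Nat.exists_eq_add_of_le' hkr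
      have h1 := h.orthogonal i (by omega)
      have h2 := hL0 (X ^ i * nodePoly w) (dvd_mul_left _ _)
      have h3 : degree (X ^ (i + r) - X ^ i * nodePoly w) < ((i + r : ℕ) : WithBot ℕ) := by
        have hd : degree (X ^ i * nodePoly w) = ((i + r : ℕ) : WithBot ℕ) := by
          rw [degree_mul, degree_X_pow, degree_nodePoly]; rfl
        conv_rhs => rw [← degree_X_pow (R := ℂ) (i + r)]
        refine degree_sub_lt_left (by rw [hd, degree_X_pow]) (pow_ne_zero _ X_ne_zero) ?_
        rw [leadingCoeff_X_pow]
        exact ((monic_X_pow i).mul (nodePoly_monic w)).symm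
      have h4 := linearMap_eq_of_degree_lt (fun m hm => ih m hm (by omega)) h3
      rwa [map_sub, map_sub, h1, h2, sub_zero, sub_zero] at h4

theorem IsPronySolution.unique {r : ℕ} {μ : Fin (2 * r) → ℂ} (hμ : (squareHankel μ).det ≠ 0)
    {w w' : Fin r → ℂ} {g g' : (ℂ → ℂ) → ℂ} (h : IsPronySolution μ w g)
    (h' : IsPronySolution μ w' g') : g' = g ∧ ∃ σ : Equiv.Perm (Fin r), w' = w ∘ σ := by
  have hw := h'.isDenom.unique hμ h.isDenom
  refine ⟨signal_ext (signalSpace_congr hw ▸ h'.1) h.1 fun k hk => ?_,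
    exists_perm_of_nodePoly_eq hw⟩
  rw [h.2 ⟨k, by omega⟩, h'.2 ⟨k, by omega⟩]

/-- The moments `m_0, …, m_{2r-1}` of the signal with nodes `w` and initial moments `a`. -/
def momentsOf {r : ℕ} (w a : Fin r → ℂ) : Fin (2 * r) → ℂ := fun k => moment (signalWith w a) k

theorem isPronySolution_momentsOf {r : ℕ} (w a : Fin r → ℂ) :
    IsPronySolution (momentsOf w a) w (signalWith w a) :=
  ⟨signalWith_mem w a, fun _ => rfl⟩

theorem initialMoments_momentsOf {r : ℕ} (w a : Fin r → ℂ) :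
    initialMoments (momentsOf w a) = a :=
  funext fun k => moment_signalWith_of_lt w a k

/-- Nodes and initial moments recover `μ`; this makes them usable as coordinates. -/
theorem IsDenom.eq_momentsOf {r : ℕ} {μ : Fin (2 * r) → ℂ} {w : Fin r → ℂ}
    (h : IsDenom μ (nodePoly w)) : μ = momentsOf w (initialMoments μ) :=
  funext fun k => (h.isPronySolution.2 k).symm

/-! ### The Stieltjes transform -/

/-- With `Q` the node polynomial, the difference of the two functions is `Q(x) / (Q(z) (z - x))`,
which vanishes at each node to the order of its multiplicity. -/
theorem sameJets_inv_sub {r : ℕ} {w : Fin r → ℂ} {z : ℂ} (hz : z ∉ Set.range w) :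
    SameJets w (fun x => (z - x)⁻¹)
      fun x => (C ((nodePoly w).eval z)⁻¹ * polyDiff z (nodePoly w)).eval x := by
  intro i ℓ hℓ
  set Q := nodePoly w with hQ
  set H := C (Q.eval z)⁻¹ * polyDiff z Q with hH
  have hzi : z - w i ≠ 0 := sub_ne_zero.2 fun h => hz ⟨i, h.symm⟩
  have hQz : Q.eval z ≠ 0 := fun h => hz ((eval_nodePoly_eq_zero_iff w z).1 h)
  obtain ⟨q, hq⟩ := X_sub_C_pow_mult_dvd_nodePoly w i
  have han1 : AnalyticAt ℂ (fun x : ℂ => (z - x)⁻¹) (w i) :=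
    (analyticAt_const.sub analyticAt_id).inv hzi
  have han2 : AnalyticAt ℂ (fun x : ℂ => H.eval x) (w i) := by
    simpa using AnalyticAt.aeval_polynomial (analyticAt_id (𝕜 := ℂ) (z := w i)) H
  have hqan : AnalyticAt ℂ (fun x : ℂ => q.eval x) (w i) := by
    simpa using AnalyticAt.aeval_polynomial (analyticAt_id (𝕜 := ℂ) (z := w i)) q
  have hord : ((mult w i : ℕ) : ℕ∞) ≤
      analyticOrderAt ((fun x : ℂ => (z - x)⁻¹) - fun x => H.eval x) (w i) := by
    rw [natCast_le_analyticOrderAt (han1.sub han2)]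
    refine ⟨fun x => q.eval x * ((Q.eval z)⁻¹ * (z - x)⁻¹),
      hqan.mul (analyticAt_const.mul han1), ?_⟩
    have hev : ∀ᶠ x in 𝓝 (w i), z - x ≠ 0 :=
      (continuous_const.sub continuous_id).continuousAt.eventually_ne hzi
    filter_upwards [hev] with x hx
    have h1 := congrArg (fun p => p.eval x) (polyDiff_mul z Q)
    have h2 := congrArg (fun p => p.eval x) hq
    simp only [eval_mul, eval_sub, eval_X, eval_C, eval_pow] at h1 h2
    simp only [Pi.sub_apply, hH, eval_mul, eval_C, smul_eq_mul]
    field_simp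
    linear_combination h1 + h2
  have := (natCast_le_analyticOrderAt_iff_iteratedDeriv_eq_zero (han1.sub han2)).1 hord ℓ hℓ
  rw [iteratedDeriv_sub han1.contDiffAt han2.contDiffAt] at this
  exact sub_eq_zero.1 this

theorem IsPronySolution.stieltjes_eq {r : ℕ} {μ : Fin (2 * r) → ℂ} {w : Fin r → ℂ}
    {g : (ℂ → ℂ) → ℂ} (h : IsPronySolution μ w g) {z : ℂ} (hz : z ∉ Set.range w) :
    stieltjes g z = (numerator (momentMap μ) (nodePoly w)).eval z / (nodePoly w).eval z := by
  have hd : (polyDiff z (nodePoly w)).degree < r :=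
    degree_polyDiff_lt z (by rw [degree_nodePoly]; exact_mod_cast Nat.lt_succ_self r)
  rw [stieltjes, apply_eq_of_sameJets h.1 (sameJets_inv_sub hz), h.apply_eval, ← smul_eq_C_mul,
    map_smul, eval_numerator, smul_eq_mul, div_eq_inv_mul]
  rw [degree_C_mul (inv_ne_zero fun h => hz ((eval_nodePoly_eq_zero_iff w z).1 h))]
  exact hd.trans_le (by exact_mod_cast (by omega))

/-! ### Polynomial dependence on the nodes -/

/-- Division by a monic polynomial works over any commutative ring: divide with indeterminate nodes,
then specialise. -/
theorem exists_eval_eq_coeff_modByMonic {n : ℕ} (Y : Finset (Fin n)) (k j : ℕ) :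
    ∃ D : MvPolynomial (Fin n) ℂ, ∀ w : Fin n → ℂ,
      (X ^ k %ₘ ∏ i ∈ Y, (X - C (w i))).coeff j = MvPolynomial.eval w D := by
  refine ⟨(X ^ k %ₘ ∏ i ∈ Y, (X - C (MvPolynomial.X i : MvPolynomial (Fin n) ℂ))).coeff j,
    fun w => ?_⟩
  rw [← coeff_map, map_modByMonic _ (monic_prod_of_monic _ _ fun i _ => monic_X_sub_C _)]
  simp [Polynomial.map_prod]

theorem continuous_coeff_nodePoly {n : ℕ} (j : ℕ) :
    Continuous fun w : Fin n → ℂ => (nodePoly w).coeff j := by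
  let D : MvPolynomial (Fin n) ℂ :=
    (∏ i, (X - C (MvPolynomial.X i : MvPolynomial (Fin n) ℂ))).coeff j
  have : (fun w : Fin n → ℂ => (nodePoly w).coeff j) = fun w => MvPolynomial.eval w D := by
    ext w
    rw [← coeff_map]
    simp [Polynomial.map_prod, nodePoly]
  rw [this]
  exact MvPolynomial.continuous_eval D

theorem continuous_momentsOf {r : ℕ} :
    Continuous fun q : (Fin r → ℂ) × (Fin r → ℂ) => momentsOf q.1 q.2 := by
  refine continuous_pi fun k => ?_
  simp only [momentsOf, moment_signalWith]
  refine continuous_finsetSum _ fun j _ => ((continuous_apply j).comp continuous_snd).mul ?_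
  obtain ⟨D, hD⟩ := exists_eval_eq_coeff_modByMonic (Finset.univ : Finset (Fin r)) (k : ℕ) (j : ℕ)
  have : (fun w : Fin r → ℂ => (X ^ (k : ℕ) %ₘ nodePoly w).coeff j) =
      fun w => MvPolynomial.eval w D := funext hD
  exact (this ▸ MvPolynomial.continuous_eval D).comp continuous_fst

theorem continuous_squareHankel {r : ℕ} :
    Continuous (squareHankel : (Fin (2 * r) → ℂ) → Matrix (Fin r) (Fin r) ℂ) :=
  continuous_matrix fun _ _ => continuous_apply _

theorem continuousAt_matrix_inv {X ι : Type*} [TopologicalSpace X] [Fintype ι] [DecidableEq ι]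
    {A : X → Matrix ι ι ℂ} {x : X} (hA : ContinuousAt A x) (h : (A x).det ≠ 0) :
    ContinuousAt (fun y => (A y)⁻¹) x := by
  simp only [Matrix.inv_def, Ring.inverse_eq_inv']
  have h1 : ContinuousAt (fun y => (A y).det) x :=
    (continuous_id.matrix_det.continuousAt (x := A x)).comp hA
  have h2 : ContinuousAt (fun y => (A y).adjugate) x :=
    (continuous_id.matrix_adjugate.continuousAt (x := A x)).comp hA
  exact (h1.inv₀ h).smul h2

theorem continuousAt_matrix_mulVec {X ι κ : Type*} [TopologicalSpace X] [Fintype κ]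
    {A : X → Matrix ι κ ℂ} {v : X → κ → ℂ} {x : X} (hA : ContinuousAt A x)
    (hv : ContinuousAt v x) : ContinuousAt (fun y => (A y).mulVec (v y)) x := by
  refine continuousAt_pi.2 fun i => tendsto_finsetSum _ fun j _ => ?_
  exact ((continuousAt_pi.1 (continuousAt_pi.1 hA i)) j).mul (continuousAt_pi.1 hv j)

theorem continuousAt_coeff_hankelDenom {r : ℕ} {μ : Fin (2 * r) → ℂ}
    (hμ : (squareHankel μ).det ≠ 0) (j : ℕ) :
    ContinuousAt (fun ν : Fin (2 * r) → ℂ => (hankelDenom ν).coeff j) μ := by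
  have h1 := continuousAt_matrix_inv (continuous_squareHankel (r := r)).continuousAt hμ
  have h2 : ContinuousAt (fun ν : Fin (2 * r) → ℂ => fun i : Fin r => ν ⟨i + r, by omega⟩) μ :=
    (continuous_pi fun i => continuous_apply _).continuousAt
  have h3 := continuousAt_matrix_mulVec h1 h2
  simp only [hankelDenom, coeff_sub, finsetSum_coeff, coeff_C_mul]
  refine continuousAt_const.sub (tendsto_finsetSum _ fun i _ => ?_)
  exact ((continuousAt_pi.1 h3) i).mul continuousAt_const

/-! ### Continuity of roots -/

theorem dist_comp_perm {n : ℕ} (f g : Fin n → ℂ) (σ : Equiv.Perm (Fin n)) :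
    dist (f ∘ σ) (g ∘ σ) = dist f g := by
  apply le_antisymm
  · exact (dist_pi_le_iff dist_nonneg).2 fun i => dist_le_pi_dist f g (σ i)
  · refine (dist_pi_le_iff dist_nonneg).2 fun i => ?_
    have := dist_le_pi_dist (f ∘ σ) (g ∘ σ) (σ.symm i)
    simpa using this

theorem norm_le_of_coeff_nodePoly {n : ℕ} {w : Fin n → ℂ} {B : ℝ} (hB : 0 ≤ B)
    (h : ∀ j < n, ‖(nodePoly w).coeff j‖ ≤ B) : ‖w‖ ≤ B + 1 := by
  refine (pi_norm_le_iff_of_nonneg (by linarith)).2 fun i => ?_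
  have h1 := IsRoot.norm_lt_cauchyBound (nodePoly_monic w).ne_zero (a := w i)
    ((eval_nodePoly_eq_zero_iff w _).2 ⟨i, rfl⟩)
  have h2 : cauchyBound (nodePoly w) ≤ ⟨B, hB⟩ + 1 := by
    rw [cauchyBound, (nodePoly_monic w).leadingCoeff, nnnorm_one, div_one, natDegree_nodePoly]
    refine add_le_add (Finset.sup_le fun j hj => ?_) le_rfl
    exact h j (Finset.mem_range.1 hj)
  exact_mod_cast (h1.le.trans h2)

/-- Continuity of roots by compactness: the coefficient map is continuous, its fibres are
permutation orbits, and Cauchy's root bound confines the nodes to a compact ball. -/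
theorem eventually_exists_perm_dist_lt {ι : Type*} {l : Filter ι} {n : ℕ} {u : ι → Fin n → ℂ}
    {w : Fin n → ℂ}
    (h : ∀ j, Tendsto (fun i => (nodePoly (u i)).coeff j) l (𝓝 ((nodePoly w).coeff j)))
    {ε : ℝ} (hε : 0 < ε) :
    ∀ᶠ i in l, ∃ σ : Equiv.Perm (Fin n), dist (u i ∘ σ) w < ε := by
  let c : (Fin n → ℂ) → (Fin n → ℂ) := fun w j => (nodePoly w).coeff j
  have hc : Continuous c := continuous_pi fun j => continuous_coeff_nodePoly j
  have hcu : Tendsto (fun i => c (u i)) l (𝓝 (c w)) := tendsto_pi_nhds.2 fun j => h j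
  have hinj : ∀ w', c w' = c w → nodePoly w' = nodePoly w := fun w' h' => by
    ext j
    rcases lt_trichotomy j n with hj | rfl | hj
    · exact congrFun h' ⟨j, hj⟩
    · have h1 := nodePoly_monic w
      have h2 := nodePoly_monic w'
      rw [Monic, leadingCoeff, natDegree_nodePoly] at h1 h2
      rw [h1, h2]
    · rw [coeff_eq_zero_of_natDegree_lt, coeff_eq_zero_of_natDegree_lt] <;>
        rwa [natDegree_nodePoly]
  let B := ‖c w‖ + 1
  -- Bounded node vectors with no reordering `ε`-close to `w`. Their coefficients form a compact set
  -- that misses those of `w`.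
  let K := Metric.closedBall (0 : Fin n → ℂ) (B + 1) ∩
    {w' | ∀ σ : Equiv.Perm (Fin n), ε ≤ dist (w' ∘ σ) w}
  have hK : IsCompact K := by
    refine (isCompact_closedBall _ _).inter_right ?_
    simp only [Set.ofPred_forall]
    refine isClosed_iInter fun σ => isClosed_le continuous_const ?_
    exact (continuous_pi fun i => continuous_apply _).dist continuous_const
  have hwK : c w ∈ (c '' K)ᶜ := by
    rintro ⟨w', ⟨-, h2⟩, h3⟩
    obtain ⟨σ, rfl⟩ := exists_perm_of_nodePoly_eq (hinj w' h3)
    have := h2 σ⁻¹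
    have h4 : (w ∘ σ) ∘ (σ⁻¹ : Equiv.Perm (Fin n)) = w := by ext i; simp
    rw [h4, dist_self] at this
    linarith
  have h1 := hcu.eventually ((hK.image hc).isClosed.isOpen_compl.mem_nhds hwK)
  have h2 := hcu.norm.eventually (gt_mem_nhds (lt_add_one ‖c w‖))
  filter_upwards [h1, h2] with i hi1 hi2
  by_contra! hi3
  refine hi1 ⟨u i, ⟨?_, hi3⟩, rfl⟩
  rw [mem_closedBall_zero_iff]
  refine norm_le_of_coeff_nodePoly (by positivity) fun j hj => ?_
  exact (norm_le_pi_norm (c (u i)) ⟨j, hj⟩).trans hi2.le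

theorem eventually_det_ne_zero {r : ℕ} {μ : Fin (2 * r) → ℂ} (hμ : (squareHankel μ).det ≠ 0) :
    ∀ᶠ ν in 𝓝 μ, (squareHankel ν).det ≠ 0 :=
  continuous_squareHankel.matrix_det.continuousAt.eventually_ne hμ

theorem eventually_exists_isDenom_dist_lt {r : ℕ} {μ : Fin (2 * r) → ℂ}
    (hμ : (squareHankel μ).det ≠ 0) {w : Fin r → ℂ} (hw : IsDenom μ (nodePoly w))
    {ε : ℝ} (hε : 0 < ε) :
    ∀ᶠ ν in 𝓝 μ, ∃ w', IsDenom ν (nodePoly w') ∧ dist w' w < ε := by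
  have hex : ∀ ν : Fin (2 * r) → ℂ, ∃ w' : Fin r → ℂ,
      (squareHankel ν).det ≠ 0 → nodePoly w' = hankelDenom ν := fun ν => by
    by_cases h : (squareHankel ν).det = 0
    · exact ⟨0, fun h' => absurd h h'⟩
    · have hd := isDenom_hankelDenom h
      obtain ⟨w', hw'⟩ := exists_nodePoly_eq hd.monic hd.natDegree_eq
      exact ⟨w', fun _ => hw'⟩
  choose u hu using hex
  have ht : ∀ j, Tendsto (fun ν => (nodePoly (u ν)).coeff j) (𝓝 μ) (𝓝 ((nodePoly w).coeff j)) := by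
    intro j
    have h1 := continuousAt_coeff_hankelDenom hμ j
    rw [ContinuousAt, (isDenom_hankelDenom hμ).unique hμ hw] at h1
    refine h1.congr' ?_
    filter_upwards [eventually_det_ne_zero hμ] with ν hν
    rw [hu ν hν]
  filter_upwards [eventually_det_ne_zero hμ, eventually_exists_perm_dist_lt ht hε] with ν hν ⟨σ, hσ⟩
  refine ⟨u ν ∘ σ, ?_, hσ⟩
  rw [nodePoly_comp_perm, hu ν hν]
  exact isDenom_hankelDenom hν

/-! ### Continuous multivalued functions -/

theorem IsContinuousMultivaluedOn.image {A E E' : Type*} [TopologicalSpace A] [PseudoMetricSpace E]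
    [PseudoMetricSpace E'] {F : A → Set E} {U : Set A} (hF : IsContinuousMultivaluedOn F U)
    {β : A × E → E'} (hβ : ContinuousOn β {q | q.1 ∈ U ∧ q.2 ∈ F q.1}) :
    IsContinuousMultivaluedOn (fun a => (fun y => β (a, y)) '' F a) U := by
  have key : ∀ a ∈ U, ∀ ε > 0, ∀ y ∈ F a, ∃ δ > 0, ∀ᶠ b in 𝓝[U] a, ∀ y' ∈ F b, dist y' y < δ →
      dist (β (b, y')) (β (a, y)) < ε := by
    intro a ha ε hε y hy
    have h1 := (hβ (a, y) ⟨ha, hy⟩).eventually (Metric.ball_mem_nhds _ hε)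
    rw [eventually_nhdsWithin_iff, nhds_prod_eq,
      (((𝓝 a).basis_sets).prod Metric.nhds_basis_ball).eventually_iff] at h1
    obtain ⟨⟨V, δ⟩, ⟨hV, hδ⟩, h1⟩ := h1
    refine ⟨δ, hδ, ?_⟩
    filter_upwards [self_mem_nhdsWithin, mem_nhdsWithin_of_mem_nhds hV] with b hb hbV y' hy' hd
    exact h1 (x := (b, y')) ⟨hbV, hd⟩ ⟨hb, hy'⟩
  refine ⟨fun a ha => (hF.nonempty a ha).image _, fun a ha => (hF.finite a ha).image _, ?_, ?_⟩
  · intro a ha ε hε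
    have : ∀ y ∈ F a, ∀ᶠ b in 𝓝[U] a, ∃ y' ∈ F b, dist (β (b, y')) (β (a, y)) < ε := by
      intro y hy
      obtain ⟨δ, hδ, h⟩ := key a ha ε hε y hy
      filter_upwards [h, hF.lower a ha δ hδ] with b h1 h2
      obtain ⟨y', hy', hd⟩ := h2 y hy
      exact ⟨y', hy', h1 y' hy' hd⟩
    filter_upwards [(eventually_all_finite (hF.finite a ha)).2 this] with b hb
    rintro _ ⟨y, hy, rfl⟩
    obtain ⟨y', hy', hd⟩ := hb y hy
    exact ⟨_, ⟨y', hy', rfl⟩, hd⟩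
  · intro a ha ε hε
    choose! δ hδ h using key a ha ε hε
    -- One radius serves all values at `a`, since there are finitely many.
    obtain ⟨η, hη1, hη⟩ : ∃ η, (∀ y ∈ F a, η < δ y) ∧ 0 < η := by
      have h1 : ∀ᶠ η in 𝓝[>] (0 : ℝ), ∀ y ∈ F a, η < δ y :=
        (eventually_all_finite (hF.finite a ha)).2 fun y hy =>
          mem_nhdsWithin_of_mem_nhds (gt_mem_nhds (hδ y hy))
      exact (h1.and self_mem_nhdsWithin).exists
    filter_upwards [(eventually_all_finite (hF.finite a ha)).2 h, hF.upper a ha η hη] with b h1 h2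
    rintro _ ⟨y', hy', rfl⟩
    obtain ⟨y, hy, hd⟩ := h2 y' hy'
    exact ⟨_, ⟨y, hy, rfl⟩, h1 y hy y' hy' (hd.trans (hη1 y hy))⟩

/-! ### Cells -/

/-- The right-hand sides whose nodes and initial moments are `ε`-close to `w₀` and `a₀`. -/
def cell {r : ℕ} (w₀ a₀ : Fin r → ℂ) (ε : ℝ) : Set (Fin (2 * r) → ℂ) :=
  (fun q : (Fin r → ℂ) × (Fin r → ℂ) => momentsOf q.1 q.2) ''
    (Metric.ball w₀ ε ×ˢ Metric.ball a₀ ε)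

/-- The radius `ε` is small enough to separate the clusters of `w₀`, and the Padé problem is
nondegenerate on the cell. -/
structure IsCellRadius {r : ℕ} (w₀ a₀ : Fin r → ℂ) (ε : ℝ) : Prop where
  pos : 0 < ε
  separated : ∀ k l, w₀ k ≠ w₀ l → 3 * ε ≤ ‖w₀ k - w₀ l‖
  det_ne_zero : ∀ μ ∈ cell w₀ a₀ ε, (squareHankel μ).det ≠ 0

theorem exists_isCellRadius {r : ℕ} {w₀ a₀ : Fin r → ℂ}
    (h : (squareHankel (momentsOf w₀ a₀)).det ≠ 0) {N : Set (Fin (2 * r) → ℂ)}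
    (hN : N ∈ 𝓝 (momentsOf w₀ a₀)) : ∃ ε, IsCellRadius w₀ a₀ ε ∧ cell w₀ a₀ ε ⊆ N := by
  have h1 : ∀ᶠ q in 𝓝 (w₀, a₀), (squareHankel (momentsOf q.1 q.2)).det ≠ 0 ∧
      momentsOf q.1 q.2 ∈ N :=
    (continuous_momentsOf.continuousAt (x := (w₀, a₀))).eventually
      ((eventually_det_ne_zero h).and hN)
  obtain ⟨η, hη, h1⟩ := Metric.eventually_nhds_iff_ball.1 h1
  have h2 : ∀ᶠ ε in 𝓝[>] (0 : ℝ), ∀ k l, w₀ k ≠ w₀ l → ε < ‖w₀ k - w₀ l‖ / 3 := by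
    refine eventually_all.2 fun k => eventually_all.2 fun l => ?_
    by_cases hkl : w₀ k = w₀ l
    · simp [hkl]
    · have : 0 < ‖w₀ k - w₀ l‖ / 3 := by
        have := norm_pos_iff.2 (sub_ne_zero.2 hkl)
        positivity
      filter_upwards [mem_nhdsWithin_of_mem_nhds (gt_mem_nhds this)] with ε hε _ using hε
  have h3 : ∀ᶠ ε in 𝓝[>] (0 : ℝ), ε < η := mem_nhdsWithin_of_mem_nhds (gt_mem_nhds hη)
  obtain ⟨ε, ⟨h2, h3⟩, h4⟩ := ((h2.and h3).and self_mem_nhdsWithin).exists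
  have h5 : ∀ μ ∈ cell w₀ a₀ ε, (squareHankel μ).det ≠ 0 ∧ μ ∈ N := by
    rintro _ ⟨q, ⟨hq1, hq2⟩, rfl⟩
    refine h1 q ?_
    rw [Metric.mem_ball, Prod.dist_eq]
    exact max_lt (lt_trans hq1 h3) (lt_trans hq2 h3)
  exact ⟨ε, ⟨h4, fun k l hkl => by linarith [h2 k l hkl], fun μ hμ => (h5 μ hμ).1⟩,
    fun μ hμ => (h5 μ hμ).2⟩

theorem mem_cell_iff {r : ℕ} {w₀ a₀ : Fin r → ℂ} {ε : ℝ} {μ : Fin (2 * r) → ℂ} :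
    μ ∈ cell w₀ a₀ ε ↔ initialMoments μ ∈ Metric.ball a₀ ε ∧
      ∃ w ∈ Metric.ball w₀ ε, IsDenom μ (nodePoly w) := by
  constructor
  · rintro ⟨⟨w, a⟩, ⟨hw, ha⟩, rfl⟩
    exact ⟨(initialMoments_momentsOf w a).symm ▸ ha, w, hw,
      (isPronySolution_momentsOf w a).isDenom⟩
  · rintro ⟨ha, w, hw, h⟩
    exact ⟨(w, initialMoments μ), ⟨hw, ha⟩, h.eq_momentsOf.symm⟩

theorem continuous_initialMoments {r : ℕ} :
    Continuous (initialMoments : (Fin (2 * r) → ℂ) → Fin r → ℂ) :=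
  continuous_pi fun _ => continuous_apply _

namespace IsCellRadius

variable {r : ℕ} {w₀ a₀ : Fin r → ℂ} {ε : ℝ}

/-- Nearby right-hand sides have nearby roots, and the slack of `w` in the open ball absorbs the
displacement. -/
theorem isOpen_cell (h : IsCellRadius w₀ a₀ ε) : IsOpen (cell w₀ a₀ ε) := by
  refine isOpen_iff_mem_nhds.2 fun μ hμ => ?_
  obtain ⟨ha, w, hw, hd⟩ := mem_cell_iff.1 hμ
  have h1 := continuous_initialMoments.continuousAt.eventually (Metric.isOpen_ball.mem_nhds ha)
  have h2 := eventually_exists_isDenom_dist_lt (h.det_ne_zero μ hμ) hd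
    (sub_pos.2 (Metric.mem_ball.1 hw))
  filter_upwards [h1, h2] with ν hν1 ⟨w', hw', hdist⟩
  refine mem_cell_iff.2 ⟨hν1, w', ?_, hw'⟩
  rw [Metric.mem_ball]
  linarith [dist_triangle w' w w₀]

/-- A reordering of a point of the ball lies in the ball unless it mixes up the clusters. -/
theorem comp_perm_mem_ball (h : IsCellRadius w₀ a₀ ε) {w : Fin r → ℂ} (hw : w ∈ Metric.ball w₀ ε)
    (σ : Equiv.Perm (Fin r))
    (hσ : ∀ i, ‖w (σ i) - w₀ i‖ < 2 * ε ∨ ∀ k l, w₀ k ≠ w₀ l →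
      ‖w (σ i) - w₀ i‖ ≤ ‖w₀ k - w₀ l‖ / 3) :
    w ∘ σ ∈ Metric.ball w₀ ε := by
  rw [Metric.mem_ball, dist_pi_lt_iff h.pos] at hw ⊢
  intro i
  have h1 := hw (σ i)
  suffices w₀ (σ i) = w₀ i by rw [← this]; exact h1
  -- Otherwise `σ` mixes two clusters at distance `D ≥ 3ε`. The triangle inequality gives `D < ε +
  -- 2ε` or `D < ε + D / 3`, both impossible.
  by_contra hne
  have h2 := h.separated _ _ hne
  have h3 := hσ i
  have h4 : ‖w₀ (σ i) - w₀ i‖ ≤ dist (w (σ i)) (w₀ (σ i)) + ‖w (σ i) - w₀ i‖ := by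
    rw [← dist_eq_norm, ← dist_eq_norm]; exact dist_triangle_left _ _ _
  rcases h3 with h3 | h3
  · linarith
  · linarith [h3 _ _ hne, h.pos]

/-- A gap property: an enumeration of the roots that is coarsely close to `w₀` is within `ε` of it.
The first alternative serves continuation, the second the condition on base points. -/
theorem mem_ball_of_isDenom (h : IsCellRadius w₀ a₀ ε) {μ : Fin (2 * r) → ℂ}
    (hμ : μ ∈ cell w₀ a₀ ε) {w : Fin r → ℂ} (hw : IsDenom μ (nodePoly w))
    (hd : ∀ i, ‖w i - w₀ i‖ < 2 * ε ∨ ∀ k l, w₀ k ≠ w₀ l → ‖w i - w₀ i‖ ≤ ‖w₀ k - w₀ l‖ / 3) :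
    w ∈ Metric.ball w₀ ε := by
  obtain ⟨-, w', hw', hd'⟩ := mem_cell_iff.1 hμ
  obtain ⟨σ, rfl⟩ := exists_perm_of_nodePoly_eq (hw.unique (h.det_ne_zero μ hμ) hd')
  exact h.comp_perm_mem_ball hw' σ hd

theorem isSubordinated (h : IsCellRadius w₀ a₀ ε) {𝒞 : Configuration r}
    (hsub : IsSubordinated w₀ 𝒞) {w : Fin r → ℂ} (hw : w ∈ Metric.closedBall w₀ ε) :
    IsSubordinated w 𝒞 := by
  intro k l hkl hwkl
  refine hsub k l hkl ?_
  by_contra hne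
  have h1 := h.separated _ _ hne
  rw [Metric.mem_closedBall, dist_pi_le_iff h.pos.le] at hw
  have h2 := hw k
  have h3 := hw l
  rw [← dist_eq_norm] at h1
  rw [hwkl] at h2
  linarith [dist_triangle_left (w₀ k) (w₀ l) (w l), h.pos]

/-- The nodes of the right-hand sides in the cell, enumerated so that they are close to `w₀`. -/
def localNodes (w₀ : Fin r → ℂ) (ε : ℝ) (μ : Fin (2 * r) → ℂ) : Set (Fin r → ℂ) :=
  {w | w ∈ Metric.ball w₀ ε ∧ IsDenom μ (nodePoly w)}

/-- All values at a point are reorderings of one. A nearby enumeration at the other point is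
reordered by the same permutation, and the gap property keeps the result in the ball. -/
theorem isContinuousMultivaluedOn_localNodes (h : IsCellRadius w₀ a₀ ε) :
    IsContinuousMultivaluedOn (localNodes w₀ ε) (cell w₀ a₀ ε) := by
  refine ⟨fun μ hμ => (mem_cell_iff.1 hμ).2, fun μ hμ => ?_, fun μ hμ η hη => ?_,
    fun μ hμ η hη => ?_⟩
  · obtain ⟨-, w, hw, hd⟩ := mem_cell_iff.1 hμ
    refine (Set.finite_range fun σ : Equiv.Perm (Fin r) => w ∘ σ).subset fun w' hw' => ?_
    obtain ⟨σ, rfl⟩ := exists_perm_of_nodePoly_eq (hw'.2.unique (h.det_ne_zero μ hμ) hd)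
    exact ⟨σ, rfl⟩
  · obtain ⟨-, w, hw, hd⟩ := mem_cell_iff.1 hμ
    have hmem := self_mem_nhdsWithin (s := cell w₀ a₀ ε) (a := μ)
    have h1 := eventually_exists_isDenom_dist_lt (h.det_ne_zero μ hμ) hd (lt_min hη h.pos)
    filter_upwards [hmem, mem_nhdsWithin_of_mem_nhds h1] with ν hν ⟨w', hw', hdist⟩ y hy
    obtain ⟨σ, rfl⟩ := exists_perm_of_nodePoly_eq (hy.2.unique (h.det_ne_zero μ hμ) hd)
    have hdist' : dist (w' ∘ σ) (w ∘ σ) < min η ε := by rwa [dist_comp_perm]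
    have hden : IsDenom ν (nodePoly (w' ∘ σ)) := by rwa [nodePoly_comp_perm]
    refine ⟨w' ∘ σ, ⟨h.mem_ball_of_isDenom hν hden fun i => Or.inl ?_, hden⟩,
      hdist'.trans_le (min_le_left _ _)⟩
    rw [← dist_eq_norm]
    have e1 := dist_le_pi_dist (w' ∘ σ) w₀ i
    have e2 := dist_triangle (w' ∘ σ) (w ∘ σ) w₀
    have e3 := Metric.mem_ball.1 hy.1
    have e4 := hdist'.trans_le (min_le_right _ _)
    linarith
  · obtain ⟨-, w, hw, hd⟩ := mem_cell_iff.1 hμ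
    have hmem := self_mem_nhdsWithin (s := cell w₀ a₀ ε) (a := μ)
    have h1 := eventually_exists_isDenom_dist_lt (h.det_ne_zero μ hμ) hd (lt_min hη h.pos)
    filter_upwards [hmem, mem_nhdsWithin_of_mem_nhds h1] with ν hν ⟨w', hw', hdist⟩ y hy
    obtain ⟨σ, rfl⟩ := exists_perm_of_nodePoly_eq (hy.2.unique (h.det_ne_zero ν hν) hw')
    have hdist' : dist (w' ∘ σ) (w ∘ σ) < min η ε := by rwa [dist_comp_perm]
    have hden : IsDenom μ (nodePoly (w ∘ σ)) := by rwa [nodePoly_comp_perm]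
    refine ⟨w ∘ σ, ⟨h.mem_ball_of_isDenom hμ hden fun i => Or.inl ?_, hden⟩,
      hdist'.trans_le (min_le_left _ _)⟩
    rw [← dist_eq_norm]
    have e1 := dist_le_pi_dist (w ∘ σ) w₀ i
    have e2 := dist_triangle_left (w ∘ σ) w₀ (w' ∘ σ)
    have e3 := Metric.mem_ball.1 hy.1
    have e4 := hdist'.trans_le (min_le_right _ _)
    linarith

end IsCellRadius

/-! ### Continuation of the nodes -/

/-- Along `w₀ + t v` with `v` having distinct coordinates, each pair collides for at most one `t`.
-/
theorem exists_injective_mem_ball {r : ℕ} (w₀ : Fin r → ℂ) {ε : ℝ} (hε : 0 < ε) :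
    ∃ w ∈ Metric.ball w₀ ε, Function.Injective w := by
  let v : Fin r → ℂ := fun k => (k : ℂ)
  let s : ℝ → Fin r → ℂ := fun t => w₀ + (t : ℂ) • v
  have hs : Continuous s :=
    continuous_const.add ((Complex.continuous_ofReal).smul continuous_const)
  have h0 : ∀ᶠ t in 𝓝[>] (0 : ℝ), s t ∈ Metric.ball w₀ ε := by
    refine mem_nhdsWithin_of_mem_nhds (hs.continuousAt.preimage_mem_nhds ?_)
    simpa [s] using Metric.ball_mem_nhds w₀ hε
  obtain ⟨η, hη, h1⟩ := mem_nhdsGT_iff_exists_Ioo_subset.1 h0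
  let B : Finset ℝ := Finset.univ.image fun p : Fin r × Fin r =>
    (-(w₀ p.1 - w₀ p.2) / (v p.1 - v p.2)).re
  obtain ⟨t, ht, htB⟩ := (Set.Ioo_infinite hη).exists_notMem_finset B
  refine ⟨s t, h1 ht, fun i j hij => ?_⟩
  by_contra hne
  have hv : v i - v j ≠ 0 := sub_ne_zero.2 fun h => hne (Fin.ext (Nat.cast_injective (R := ℂ) h))
  refine htB (Finset.mem_image.2 ⟨(i, j), Finset.mem_univ _, ?_⟩)
  have h2 : (t : ℂ) = -(w₀ i - w₀ j) / (v i - v j) := by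
    rw [eq_div_iff hv]
    simp only [s, Pi.add_apply, Pi.smul_apply, smul_eq_mul] at hij
    linear_combination hij
  rw [← h2, Complex.ofReal_re]

/-- A path in a ball that avoids collisions of coordinates, except possibly at its end point. -/
theorem exists_path_injective {r : ℕ} {w₀ w₁ w : Fin r → ℂ} {ε : ℝ} (h₁ : w₁ ∈ Metric.ball w₀ ε)
    (h : w ∈ Metric.ball w₀ ε) (hinj : Function.Injective w₁) :
    ∃ ω : Path w₁ w, ∀ t, ω t ∈ Metric.ball w₀ ε ∧ (t ≠ 1 → Function.Injective (ω t)) := by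
  let v := w - w₁
  obtain ⟨M, hM1, hM2, hM⟩ : ∃ M < ε, ‖w₁ - w₀‖ ≤ M ∧ ‖w - w₀‖ ≤ M := by
    rw [mem_ball_iff_norm] at h₁ h
    exact ⟨_, max_lt h₁ h, le_max_left _ _, le_max_right _ _⟩
  -- The bound on `s` that keeps the detour in the ball: the segment stays within `M` of `w₀` and
  -- the detour adds at most `s * ‖v‖`.
  have hη : 0 < (ε - M) / (‖v‖ + 1) := div_pos (sub_pos.2 hM1) (by positivity)
  -- On the complex line `w₁ + z v`, coordinates whose difference varies collide at the single
  -- parameter `ζ p`. The arc `z = t + i s t (1 - t)` can meet it at an interior time only for the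
  -- value of `s` recorded in `B`.
  let ζ : Fin r × Fin r → ℂ := fun p => -(w₁ p.1 - w₁ p.2) / (v p.1 - v p.2)
  let B : Finset ℝ := Finset.univ.image fun p => (ζ p).im / ((ζ p).re * (1 - (ζ p).re))
  obtain ⟨s, hs, hsB⟩ := (Set.Ioo_infinite hη).exists_notMem_finset B
  let z : ℝ → ℂ := fun t => ⟨t, s * (t * (1 - t))⟩
  have hz : ∀ t, z t = t + Complex.I * (s * (t * (1 - t)) : ℝ) := fun t => by
    apply Complex.ext <;> simp [z]
  have hzc : Continuous z := by
    have : z = fun t : ℝ => (t + Complex.I * (s * (t * (1 - t)) : ℝ) : ℂ) := funext hz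
    rw [this]
    fun_prop
  let ω : Path w₁ w :=
    { toFun := fun t => w₁ + z t • v
      continuous_toFun := continuous_const.add
        ((hzc.comp continuous_subtype_val).smul continuous_const)
      source' := by simp [hz]
      target' := by simp [hz, v] }
  have hω : ∀ t : unitInterval, ω t = w₁ + z t • v := fun _ => rfl
  refine ⟨ω, fun t => ⟨?_, fun ht1 i j hij => ?_⟩⟩
  · obtain ⟨t, ht0, ht1⟩ := t
    rw [hω, mem_ball_iff_norm]
    have h1 : w₁ + z t • v - w₀ = (((1 - t : ℝ) : ℂ) • (w₁ - w₀) + (t : ℂ) • (w - w₀)) +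
        (Complex.I * (s * (t * (1 - t)) : ℝ)) • v := by
      rw [hz]
      ext i
      simp [v]
      ring
    have h2 : ‖((1 - t : ℝ) : ℂ) • (w₁ - w₀) + (t : ℂ) • (w - w₀)‖ ≤ M := by
      refine (norm_add_le _ _).trans ?_
      rw [norm_smul, norm_smul, Complex.norm_real, Complex.norm_real, Real.norm_of_nonneg ht0,
        Real.norm_of_nonneg (by linarith : (0 : ℝ) ≤ 1 - t)]
      nlinarith
    have ht : 0 ≤ t * (1 - t) := mul_nonneg ht0 (by linarith)
    have ht' : t * (1 - t) ≤ 1 := by nlinarith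
    have h3 : ‖(Complex.I * (s * (t * (1 - t)) : ℝ)) • v‖ ≤ s * ‖v‖ := by
      rw [norm_smul, norm_mul, Complex.norm_I, one_mul, Complex.norm_real,
        Real.norm_of_nonneg (mul_nonneg hs.1.le ht)]
      exact mul_le_mul_of_nonneg_right (mul_le_of_le_one_right hs.1.le ht') (norm_nonneg _)
    have h4 : s * (‖v‖ + 1) < ε - M := (lt_div_iff₀ (by positivity)).1 hs.2
    rw [h1]
    linarith [norm_add_le (((1 - t : ℝ) : ℂ) • (w₁ - w₀) + (t : ℂ) • (w - w₀))
      ((Complex.I * (s * (t * (1 - t)) : ℝ)) • v), hs.1]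
  · by_contra hne
    have hw : w₁ i - w₁ j ≠ 0 := sub_ne_zero.2 fun h => hne (hinj h)
    have h1 : z t * (v i - v j) = -(w₁ i - w₁ j) := by
      simp only [hω, Pi.add_apply, Pi.smul_apply, smul_eq_mul] at hij
      linear_combination hij
    have hv : v i - v j ≠ 0 := fun h => hw (by
      rw [h, mul_zero] at h1; exact neg_eq_zero.1 h1.symm)
    have h2 : ζ (i, j) = z t := by
      simp only [ζ]
      rw [← h1, mul_div_cancel_right₀ _ hv]
    have ht0 : (t : ℝ) ≠ 0 := fun h => hw (by
      have hz0 : z t = 0 := by rw [h, hz]; simp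
      rw [hz0, zero_mul] at h1
      exact neg_eq_zero.1 h1.symm)
    have ht1' : 1 - (t : ℝ) ≠ 0 := fun h => ht1 (Subtype.ext (sub_eq_zero.1 h).symm)
    refine hsB (Finset.mem_image.2 ⟨(i, j), Finset.mem_univ _, ?_⟩)
    simp only [h2, z]
    exact mul_div_cancel_right₀ s (mul_ne_zero ht0 ht1')

namespace IsCellRadius

variable {r : ℕ} {w₀ a₀ : Fin r → ℂ} {ε : ℝ}

theorem isPoleVector_iff (h : IsCellRadius w₀ a₀ ε) {μ : Fin (2 * r) → ℂ}
    (hμ : μ ∈ cell w₀ a₀ ε) {w : Fin r → ℂ} : IsPoleVector μ w ↔ IsDenom μ (nodePoly w) :=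
  Prony.isPoleVector_iff (h.det_ne_zero μ hμ)

theorem exists_isBasePoint (h : IsCellRadius w₀ a₀ ε) :
    ∃ μ₁ w₁, IsBasePoint (cell w₀ a₀ ε) w₀ μ₁ w₁ := by
  obtain ⟨w, hw, hinj⟩ := exists_injective_mem_ball w₀ h.pos
  have hmem : momentsOf w a₀ ∈ cell w₀ a₀ ε := ⟨(w, a₀), ⟨hw, Metric.mem_ball_self h.pos⟩, rfl⟩
  refine ⟨momentsOf w a₀, w, hmem,
    (h.isPoleVector_iff hmem).2 (isPronySolution_momentsOf w a₀).isDenom, hinj,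
    fun i k l hkl => ?_⟩
  rw [Metric.mem_ball, dist_pi_lt_iff h.pos] at hw
  rw [← dist_eq_norm]
  linarith [hw i, h.separated k l hkl]

/-- The gap property makes the set of times spent in the ball both open and closed, so a
continuation starting in the ball stays there. -/
theorem nodeValues_subset (h : IsCellRadius w₀ a₀ ε) {μ₁ : Fin (2 * r) → ℂ} {w₁ : Fin r → ℂ}
    (hb : IsBasePoint (cell w₀ a₀ ε) w₀ μ₁ w₁) (μ : Fin (2 * r) → ℂ) :
    nodeValues (cell w₀ a₀ ε) μ₁ w₁ μ ⊆ localNodes w₀ ε μ := by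
  rintro w ⟨γ, ω, hγω⟩
  have hden : ∀ t, IsDenom (γ t) (nodePoly (ω t)) := fun t =>
    (h.isPoleVector_iff (hγω t).1).1 (hγω t).2.1
  have h1 : w₁ ∈ Metric.ball w₀ ε :=
    h.mem_ball_of_isDenom hb.mem ((h.isPoleVector_iff hb.mem).1 hb.pole) fun i =>
      Or.inr (hb.close i)
  have heq : ω ⁻¹' Metric.ball w₀ ε = ω ⁻¹' Metric.closedBall w₀ ε := by
    refine Set.Subset.antisymm (Set.preimage_mono Metric.ball_subset_closedBall) fun t ht => ?_
    refine h.mem_ball_of_isDenom (hγω t).1 (hden t) fun i => Or.inl ?_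
    rw [← dist_eq_norm]
    have h2 := (dist_le_pi_dist (ω t) w₀ i).trans ht
    linarith [h.pos]
  have hclopen : IsClopen (ω ⁻¹' Metric.ball w₀ ε) :=
    ⟨heq ▸ Metric.isClosed_closedBall.preimage ω.continuous,
      Metric.isOpen_ball.preimage ω.continuous⟩
  have huniv := hclopen.eq_univ ⟨0, by simpa using h1⟩
  have h3 : (1 : unitInterval) ∈ ω ⁻¹' Metric.ball w₀ ε := huniv ▸ Set.mem_univ _
  have h4 := hden 1
  simp only [Set.mem_preimage, Path.target] at h3 h4
  exact ⟨h3, h4⟩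

theorem nodeValues_eq (h : IsCellRadius w₀ a₀ ε) {μ₁ : Fin (2 * r) → ℂ} {w₁ : Fin r → ℂ}
    (hb : IsBasePoint (cell w₀ a₀ ε) w₀ μ₁ w₁) {μ : Fin (2 * r) → ℂ} (hμ : μ ∈ cell w₀ a₀ ε) :
    nodeValues (cell w₀ a₀ ε) μ₁ w₁ μ = localNodes w₀ ε μ := by
  refine Set.Subset.antisymm (h.nodeValues_subset hb μ) ?_
  rintro w ⟨hw, hden⟩
  have hden₁ := (h.isPoleVector_iff hb.mem).1 hb.pole
  have h1 : w₁ ∈ Metric.ball w₀ ε := h.mem_ball_of_isDenom hb.mem hden₁ fun i => Or.inr (hb.close i)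
  obtain ⟨ω, hω⟩ := exists_path_injective h1 hw hb.injective
  have ha := (mem_cell_iff.1 hμ).1
  -- The initial moments are joined inside their own ball; pairing this path with that of the nodes
  -- yields the path of right-hand sides.
  have ha₁ := (mem_cell_iff.1 hb.mem).1
  obtain ⟨α, hα⟩ := ((convex_ball a₀ ε).isPathConnected ⟨_, ha⟩).joinedIn _ ha₁ _ ha
  let γ : Path μ₁ μ :=
    { toFun := fun t => momentsOf (ω t) (α t)
      continuous_toFun := continuous_momentsOf.comp (ω.continuous.prodMk α.continuous)
      source' := by simp [← hden₁.eq_momentsOf]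
      target' := by simp [← hden.eq_momentsOf] }
  have hγ : ∀ t, γ t = momentsOf (ω t) (α t) := fun _ => rfl
  refine ⟨γ, ω, fun t => ?_⟩
  have hmem : γ t ∈ cell w₀ a₀ ε := ⟨(ω t, α t), ⟨(hω t).1, hα t⟩, rfl⟩
  refine ⟨hmem, (h.isPoleVector_iff hmem).2 ?_, (hω t).2⟩
  rw [hγ]
  exact (isPronySolution_momentsOf _ _).isDenom

/-- A permutation of `w₀` that moves every coordinate by less than `ε` can only exchange equal
coordinates. -/
theorem localNodes_center (h : IsCellRadius w₀ a₀ ε) {μ : Fin (2 * r) → ℂ}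
    (hμ : (squareHankel μ).det ≠ 0) (hw₀ : IsDenom μ (nodePoly w₀)) :
    localNodes w₀ ε μ = {w₀} := by
  refine Set.eq_singleton_iff_unique_mem.2 ⟨⟨Metric.mem_ball_self h.pos, hw₀⟩, ?_⟩
  rintro w ⟨hw, hd⟩
  obtain ⟨σ, rfl⟩ := exists_perm_of_nodePoly_eq (hd.unique hμ hw₀)
  rw [Metric.mem_ball, dist_pi_lt_iff h.pos] at hw
  ext i
  by_contra hne
  have h1 := h.separated _ _ hne
  have h2 := hw i
  rw [dist_eq_norm] at h2
  simp only [Function.comp_apply] at h2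
  linarith [h.pos]

end IsCellRadius

/-! ### The linear system for the coefficients -/

theorem moment_signalOf {r : ℕ} (𝒞 : Configuration r) (w : Fin r → ℂ) (b : 𝒞.Index → ℂ) (k : ℕ) :
    moment (signalOf 𝒞 w b) k = ∑ p, b p * ddFamily 𝒞 w p (fun x => x ^ k) := by
  simp [moment, signalOf, Finset.sum_apply]

theorem signalOf_mem {r : ℕ} (𝒞 : Configuration r) (w : Fin r → ℂ) (b : 𝒞.Index → ℂ) :
    signalOf 𝒞 w b ∈ signalSpace w :=
  Submodule.sum_mem _ fun p _ => Submodule.smul_mem _ _ (ddFamily_mem 𝒞 w p)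

/-- An enumeration of the index set of a configuration. -/
def indexEquiv {r : ℕ} (𝒞 : Configuration r) : 𝒞.Index ≃ Fin r :=
  Fintype.equivFinOfCardEq (card_index 𝒞)

/-- The square matrix of the first `r` equations of the linear system. -/
def systemMatrix {r : ℕ} (𝒞 : Configuration r) (w : Fin r → ℂ) : Matrix 𝒞.Index 𝒞.Index ℂ :=
  Matrix.of fun p q => ddFamily 𝒞 w q fun x => x ^ (indexEquiv 𝒞 p : ℕ)

theorem systemMatrix_mulVec {r : ℕ} (𝒞 : Configuration r) (w : Fin r → ℂ) (b : 𝒞.Index → ℂ)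
    (p : 𝒞.Index) :
    (systemMatrix 𝒞 w).mulVec b p = moment (signalOf 𝒞 w b) (indexEquiv 𝒞 p) := by
  rw [moment_signalOf]
  simp [Matrix.mulVec, dotProduct, systemMatrix, mul_comm]

/-- A kernel vector would give a signal with `r` vanishing initial moments, that is, a linear
relation among the divided differences. -/
theorem det_systemMatrix_ne_zero {r : ℕ} {𝒞 : Configuration r} {w : Fin r → ℂ}
    (hw : IsSubordinated w 𝒞) : (systemMatrix 𝒞 w).det ≠ 0 := by
  intro h
  obtain ⟨b, hb0, hb⟩ := Matrix.exists_mulVec_eq_zero_iff.2 h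
  refine hb0 (funext fun p => Fintype.linearIndependent_iff.1 (linearIndependent_ddFamily hw) b ?_ p)
  refine signal_eq_zero (signalOf_mem 𝒞 w b) fun k hk => ?_
  have := systemMatrix_mulVec 𝒞 w b ((indexEquiv 𝒞).symm ⟨k, hk⟩)
  rw [hb] at this
  rw [Pi.zero_apply, Equiv.apply_symm_apply] at this
  exact this.symm

/-- The solution of the linear system with nodes `w` and initial moments `a`. -/
def systemSolution {r : ℕ} (𝒞 : Configuration r) (w a : Fin r → ℂ) : 𝒞.Index → ℂ :=
  (systemMatrix 𝒞 w)⁻¹.mulVec (a ∘ indexEquiv 𝒞)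

theorem systemMatrix_mulVec_systemSolution {r : ℕ} {𝒞 : Configuration r} {w : Fin r → ℂ}
    (hw : IsSubordinated w 𝒞) (a : Fin r → ℂ) :
    (systemMatrix 𝒞 w).mulVec (systemSolution 𝒞 w a) = a ∘ indexEquiv 𝒞 := by
  rw [systemSolution, Matrix.mulVec_mulVec,
    Matrix.mul_nonsing_inv _ (det_systemMatrix_ne_zero hw).isUnit, Matrix.one_mulVec]

theorem signalOf_systemSolution {r : ℕ} {𝒞 : Configuration r} {w : Fin r → ℂ}
    (hw : IsSubordinated w 𝒞) (a : Fin r → ℂ) :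
    signalOf 𝒞 w (systemSolution 𝒞 w a) = signalWith w a := by
  refine signal_ext (signalOf_mem _ _ _) (signalWith_mem _ _) fun k hk => ?_
  have h := systemMatrix_mulVec 𝒞 w (systemSolution 𝒞 w a) ((indexEquiv 𝒞).symm ⟨k, hk⟩)
  rw [systemMatrix_mulVec_systemSolution hw] at h
  rw [moment_signalWith_of_lt w a ⟨k, hk⟩]
  simpa using h.symm

/-- The first `r` equations determine the coefficients. The other `r` then hold because the signal
with these nodes and initial moments already solves the Prony problem. -/
theorem solvesSystem_iff {r : ℕ} {𝒞 : Configuration r} {μ : Fin (2 * r) → ℂ} {w : Fin r → ℂ}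
    (hw : IsSubordinated w 𝒞) (hd : IsDenom μ (nodePoly w)) (b : 𝒞.Index → ℂ) :
    SolvesSystem 𝒞 μ w b ↔ b = systemSolution 𝒞 w (initialMoments μ) := by
  constructor
  · intro h
    have h1 : (systemMatrix 𝒞 w).mulVec b = initialMoments μ ∘ indexEquiv 𝒞 := by
      ext p
      rw [systemMatrix_mulVec, moment_signalOf]
      exact h ⟨indexEquiv 𝒞 p, by omega⟩
    rw [systemSolution, ← h1, Matrix.mulVec_mulVec,
      Matrix.nonsing_inv_mul _ (det_systemMatrix_ne_zero hw).isUnit, Matrix.one_mulVec]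
  · rintro rfl k
    rw [← moment_signalOf, signalOf_systemSolution hw]
    exact hd.isPronySolution.2 k

theorem exists_eval_eq_systemMatrix {r : ℕ} (𝒞 : Configuration r) (p q : 𝒞.Index) :
    ∃ D : MvPolynomial (Fin r) ℂ, ∀ w, systemMatrix 𝒞 w p q = MvPolynomial.eval w D := by
  obtain ⟨D, hD⟩ := exists_eval_eq_coeff_modByMonic (segment 𝒞 q) (indexEquiv 𝒞 p) q.2
  refine ⟨D, fun w => ?_⟩
  rw [← hD, ← ddFamily_eval]
  simp [systemMatrix]

theorem continuous_systemMatrix {r : ℕ} (𝒞 : Configuration r) :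
    Continuous (systemMatrix 𝒞) := by
  refine continuous_matrix fun p q => ?_
  obtain ⟨D, hD⟩ := exists_eval_eq_systemMatrix 𝒞 p q
  simp only [hD]
  exact MvPolynomial.continuous_eval D

theorem continuousAt_systemSolution {r : ℕ} {𝒞 : Configuration r} {q : (Fin r → ℂ) × (Fin r → ℂ)}
    (hw : IsSubordinated q.1 𝒞) :
    ContinuousAt (fun q : (Fin r → ℂ) × (Fin r → ℂ) => systemSolution 𝒞 q.1 q.2) q := by
  refine continuousAt_matrix_mulVec (continuousAt_matrix_inv
    ((continuous_systemMatrix 𝒞).comp continuous_fst).continuousAt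
    (det_systemMatrix_ne_zero hw)) ?_
  exact (continuous_pi fun p => (continuous_apply _).comp continuous_snd).continuousAt

/-! ### Algebraicity -/

/-- The matrix `(m_{i+j})` of indeterminates. -/
def genericHankel (r : ℕ) : Matrix (Fin r) (Fin r) (MvPolynomial (Fin (2 * r)) ℂ) :=
  Matrix.of fun i j => MvPolynomial.X ⟨i + j, by omega⟩

/-- A multiple of the Padé denominator with polynomial coefficients. -/
def genericDenom (r : ℕ) : Polynomial (MvPolynomial (Fin (2 * r)) ℂ) :=
  C (genericHankel r).det * X ^ r - ∑ j : Fin r, C ((genericHankel r).adjugate.mulVec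
    (fun i => MvPolynomial.X ⟨i + r, by omega⟩) j) * X ^ (j : ℕ)

theorem map_genericHankel {r : ℕ} (μ : Fin (2 * r) → ℂ) :
    (genericHankel r).map (MvPolynomial.eval μ) = squareHankel μ := by
  ext i j
  simp [genericHankel, squareHankel]

theorem map_genericDenom {r : ℕ} {μ : Fin (2 * r) → ℂ} (hμ : (squareHankel μ).det ≠ 0) :
    (genericDenom r).map (MvPolynomial.eval μ) = C (squareHankel μ).det * hankelDenom μ := by
  have h1 : MvPolynomial.eval μ (genericHankel r).det = (squareHankel μ).det := by
    rw [RingHom.map_det, RingHom.mapMatrix_apply, map_genericHankel]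
  have h2 : ∀ j, MvPolynomial.eval μ ((genericHankel r).adjugate.mulVec
      (fun i => MvPolynomial.X ⟨i + r, by omega⟩) j) =
      (squareHankel μ).det * ((squareHankel μ)⁻¹.mulVec fun i => μ ⟨i + r, by omega⟩) j := by
    intro j
    have h3 : (genericHankel r).adjugate.map (MvPolynomial.eval μ) =
        (squareHankel μ).det • (squareHankel μ)⁻¹ := by
      rw [← RingHom.mapMatrix_apply, RingHom.map_adjugate, RingHom.mapMatrix_apply,
        map_genericHankel, Matrix.inv_def, smul_smul, Ring.inverse_eq_inv', mul_inv_cancel₀ hμ,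
        one_smul]
    rw [RingHom.map_mulVec, h3, Matrix.smul_mulVec, Pi.smul_apply, smul_eq_mul]
    congr 2
    ext i
    simp
  simp only [genericDenom, hankelDenom, Polynomial.map_sub, Polynomial.map_mul, map_C,
    Polynomial.map_pow, map_X, Polynomial.map_sum, h1, h2, mul_sub, Finset.mul_sum, C_mul,
    mul_assoc]

theorem genericDenom_ne_zero {r : ℕ} {μ : Fin (2 * r) → ℂ} (hμ : (squareHankel μ).det ≠ 0) :
    genericDenom r ≠ 0 := fun h => by
  have := map_genericDenom hμ
  rw [h, Polynomial.map_zero] at this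
  exact mul_ne_zero (C_ne_zero.2 hμ) (isDenom_hankelDenom hμ).monic.ne_zero this.symm

theorem eval_map_genericDenom {r : ℕ} {μ : Fin (2 * r) → ℂ} (hμ : (squareHankel μ).det ≠ 0)
    {w : Fin r → ℂ} (hw : IsDenom μ (nodePoly w)) (i : Fin r) :
    ((genericDenom r).map (MvPolynomial.eval μ)).eval (w i) = 0 := by
  rw [map_genericDenom hμ, eval_mul, (isDenom_hankelDenom hμ).unique hμ hw,
    (eval_nodePoly_eq_zero_iff w _).2 ⟨i, rfl⟩, mul_zero]

/-- A linear system with algebraic coefficients and regular determinant has algebraic solutions. -/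
theorem isAlgebraic_of_mulVec_eq {A R ι : Type*} [CommRing A] [IsDomain A] [CommRing R] [Algebra A R]
    [Fintype ι] [DecidableEq ι] {M : Matrix ι ι R} {b v : ι → R}
    (hM : ∀ i j, IsAlgebraic A (M i j)) (hv : ∀ i, IsAlgebraic A (v i)) (h : M.mulVec b = v)
    (hdet : M.det ∈ nonZeroDivisors R) (i : ι) : IsAlgebraic A (b i) := by
  let S := Subalgebra.algebraicClosure A R
  let M' : Matrix ι ι S := Matrix.of fun i j => ⟨M i j, hM i j⟩
  let v' : ι → S := fun i => ⟨v i, hv i⟩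
  have hM' : M'.map S.val = M := rfl
  have h1 : M.det = S.val M'.det := by
    rw [AlgHom.map_det, AlgHom.mapMatrix_apply, hM']
  -- Cramer's rule, carried out inside the subalgebra of algebraic elements.
  have h2 : M.det * b i = S.val (M'.adjugate.mulVec v' i) := by
    have h3 : M.adjugate.mulVec v = M.det • b := by
      rw [← h, Matrix.mulVec_mulVec, Matrix.adjugate_mul, Matrix.smul_mulVec, Matrix.one_mulVec]
    have h4 : M'.adjugate.map S.val = M.adjugate := by
      rw [← AlgHom.mapMatrix_apply, AlgHom.map_adjugate, AlgHom.mapMatrix_apply, hM']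
    have h5 := RingHom.map_mulVec (S.val : S →+* R) M'.adjugate v' i
    have h6 := congrFun h3 i
    rw [Pi.smul_apply, smul_eq_mul] at h6
    rw [← h6]
    refine Eq.trans ?_ h5.symm
    rw [← h4]
    rfl
  refine IsAlgebraic.of_mul hdet ?_ (h2 ▸ (M'.adjugate.mulVec v' i).2)
  rw [h1]
  exact M'.det.2

/-- Functions on `Z` form an algebra over the polynomials in `m : Z → ℂ^n`. -/
@[reducible]
def functionAlgebra {Z : Type*} {n : ℕ} (m : Z → Fin n → ℂ) :
    Algebra (MvPolynomial (Fin n) ℂ) (Z → ℂ) :=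
  (RingHom.pi fun z => MvPolynomial.eval (m z)).toAlgebra

theorem aeval_functionAlgebra {Z : Type*} {n : ℕ} (m : Z → Fin n → ℂ)
    (p : Polynomial (MvPolynomial (Fin n) ℂ)) (f : Z → ℂ) (z : Z) :
    letI := functionAlgebra m
    aeval f p z = (p.map (MvPolynomial.eval (m z))).eval (f z) := by
  let _ := functionAlgebra m
  have := hom_eval₂ p (algebraMap (MvPolynomial (Fin n) ℂ) (Z → ℂ)) (Pi.evalRingHom _ z) f
  rw [aeval_def, eval_map]
  exact this

/-- One equation must serve all `(μ, w)` at once. The coefficients are therefore treated as elements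
of the ring of functions on all admissible pairs and shown algebraic over the polynomials in `μ`. -/
theorem exists_polynomial_systemSolution {r : ℕ} (𝒞 : Configuration r) (p : 𝒞.Index)
    {μ₀ : Fin (2 * r) → ℂ} (hμ₀ : (squareHankel μ₀).det ≠ 0) :
    ∃ P : Polynomial (MvPolynomial (Fin (2 * r)) ℂ), P ≠ 0 ∧ ∀ μ w, (squareHankel μ).det ≠ 0 →
      IsDenom μ (nodePoly w) → IsSubordinated w 𝒞 →
      (P.map (MvPolynomial.eval μ)).eval (systemSolution 𝒞 w (initialMoments μ) p) = 0 := by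
  let Z := {q : (Fin (2 * r) → ℂ) × (Fin r → ℂ) // (squareHankel q.1).det ≠ 0 ∧
    IsDenom q.1 (nodePoly q.2) ∧ IsSubordinated q.2 𝒞}
  let m : Z → Fin (2 * r) → ℂ := fun z => z.1.1
  let _ := functionAlgebra m
  let A := MvPolynomial (Fin (2 * r)) ℂ
  have hbase : ∀ a : A, IsAlgebraic A (fun z : Z => MvPolynomial.eval (m z) a) := fun a =>
    isAlgebraic_algebraMap a
  have hnode : ∀ i, IsAlgebraic A (fun z : Z => z.1.2 i) := fun i => by
    refine ⟨genericDenom r, genericDenom_ne_zero hμ₀, funext fun z => ?_⟩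
    rw [aeval_functionAlgebra]
    exact eval_map_genericDenom z.2.1 z.2.2.1 i
  have hpoly : ∀ D : MvPolynomial (Fin r) ℂ,
      IsAlgebraic A (fun z : Z => MvPolynomial.eval z.1.2 D) := fun D => by
    induction D using MvPolynomial.induction_on with
    | C c => simpa using hbase (MvPolynomial.C c)
    | add D D' h h' => simp only [map_add]; exact h.add h'
    | mul_X D i h => simp only [map_mul, MvPolynomial.eval_X]; exact h.mul (hnode i)
  let M : Matrix 𝒞.Index 𝒞.Index (Z → ℂ) := Matrix.of fun i j z => systemMatrix 𝒞 z.1.2 i j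
  have hM : ∀ i j, IsAlgebraic A (M i j) := fun i j => by
    obtain ⟨D, hD⟩ := exists_eval_eq_systemMatrix 𝒞 i j
    have : M i j = fun z : Z => MvPolynomial.eval z.1.2 D := funext fun z => hD _
    exact this ▸ hpoly D
  let b : 𝒞.Index → Z → ℂ := fun i z => systemSolution 𝒞 z.1.2 (initialMoments z.1.1) i
  let v : 𝒞.Index → Z → ℂ := fun i z => initialMoments z.1.1 (indexEquiv 𝒞 i)
  have hv : ∀ i, IsAlgebraic A (v i) := fun i => by
    simpa [v, initialMoments, m] using hbase (MvPolynomial.X ⟨indexEquiv 𝒞 i, by omega⟩)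
  have hMb : M.mulVec b = v := by
    ext i z
    have := congrFun (systemMatrix_mulVec_systemSolution z.2.2.2 (initialMoments z.1.1)) i
    simpa [Matrix.mulVec, dotProduct, M, b, v, Finset.sum_apply] using this
  -- The function ring has zero divisors, but the determinant vanishes at no point.
  have hdet : M.det ∈ nonZeroDivisors (Z → ℂ) := by
    have h1 : ∀ z, M.det z ≠ 0 := fun z => by
      have := RingHom.map_det (Pi.evalRingHom (fun _ : Z => ℂ) z) M
      have h2 : M.det z = (systemMatrix 𝒞 z.1.2).det := this
      rw [h2]
      exact det_systemMatrix_ne_zero z.2.2.2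
    refine mem_nonZeroDivisors_iff_right.2 fun f hf => funext fun z => ?_
    exact (mul_eq_zero.1 (congrFun hf z)).resolve_right (h1 z)
  obtain ⟨P, hP, h⟩ := isAlgebraic_of_mulVec_eq hM hv hMb hdet p
  refine ⟨P, hP, fun μ w h1 h2 h3 => ?_⟩
  have h4 := congrFun h ⟨(μ, w), h1, h2, h3⟩
  rwa [aeval_functionAlgebra] at h4

/-! ### Continuity, bounds and algebraicity of the coefficients on a cell. -/

namespace IsCellRadius

variable {r : ℕ} {w₀ a₀ : Fin r → ℂ} {ε : ℝ}

theorem continuousOn_systemSolution (h : IsCellRadius w₀ a₀ ε) {𝒞 : Configuration r}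
    (hsub : IsSubordinated w₀ 𝒞) :
    ContinuousOn (fun q : (Fin (2 * r) → ℂ) × (Fin r → ℂ) =>
      systemSolution 𝒞 q.2 (initialMoments q.1))
      {q | q.1 ∈ cell w₀ a₀ ε ∧ q.2 ∈ localNodes w₀ ε q.1} := by
  rintro ⟨μ, w⟩ ⟨-, hw, -⟩
  have h1 : Continuous fun q : (Fin (2 * r) → ℂ) × (Fin r → ℂ) => (q.2, initialMoments q.1) :=
    continuous_snd.prodMk (continuous_initialMoments.comp continuous_fst)
  have h2 := continuousAt_systemSolution (q := (w, initialMoments μ))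
    (h.isSubordinated hsub (Metric.ball_subset_closedBall hw))
  exact (ContinuousAt.comp (f := fun q : (Fin (2 * r) → ℂ) × (Fin r → ℂ) =>
    (q.2, initialMoments q.1)) (x := (μ, w)) h2 h1.continuousAt).continuousWithinAt

/-- Subordination, hence invertibility of the system, persists on the closed balls, where a
continuous function is bounded. -/
theorem exists_bound_systemSolution (h : IsCellRadius w₀ a₀ ε) {𝒞 : Configuration r}
    (hsub : IsSubordinated w₀ 𝒞) :
    ∃ K : ℝ, ∀ μ ∈ cell w₀ a₀ ε, ∀ w ∈ localNodes w₀ ε μ, ∀ p,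
      ‖systemSolution 𝒞 w (initialMoments μ) p‖ ≤ K := by
  obtain ⟨K, hK⟩ := ((isCompact_closedBall w₀ ε).prod
    (isCompact_closedBall a₀ ε)).exists_bound_of_continuousOn
    (f := fun q : (Fin r → ℂ) × (Fin r → ℂ) => systemSolution 𝒞 q.1 q.2) fun q hq =>
    (continuousAt_systemSolution (h.isSubordinated hsub hq.1)).continuousWithinAt
  refine ⟨K, fun μ hμ w hw p => (norm_le_pi_norm _ p).trans (hK (w, initialMoments μ) ⟨?_, ?_⟩)⟩
  · exact Metric.ball_subset_closedBall hw.1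
  · exact Metric.ball_subset_closedBall (mem_cell_iff.1 hμ).1

theorem isAlgebraicMultivaluedOn_localNodes (h : IsCellRadius w₀ a₀ ε)
    (hμ₀ : (squareHankel (momentsOf w₀ a₀)).det ≠ 0) (i : Fin r) :
    IsAlgebraicMultivaluedOn (fun μ => (fun w : Fin r → ℂ => w i) '' localNodes w₀ ε μ)
      (cell w₀ a₀ ε) := by
  refine ⟨genericDenom r, genericDenom_ne_zero hμ₀, ?_⟩
  rintro μ hμ _ ⟨w, hw, rfl⟩
  exact eval_map_genericDenom (h.det_ne_zero μ hμ) hw.2 i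

theorem isAlgebraicMultivaluedOn_systemSolution (h : IsCellRadius w₀ a₀ ε) {𝒞 : Configuration r}
    (hsub : IsSubordinated w₀ 𝒞) (hμ₀ : (squareHankel (momentsOf w₀ a₀)).det ≠ 0)
    (p : 𝒞.Index) :
    IsAlgebraicMultivaluedOn (fun μ => (fun w : Fin r → ℂ =>
      systemSolution 𝒞 w (initialMoments μ) p) '' localNodes w₀ ε μ) (cell w₀ a₀ ε) := by
  obtain ⟨P, hP, hP0⟩ := exists_polynomial_systemSolution 𝒞 p hμ₀
  refine ⟨P, hP, ?_⟩
  rintro μ hμ _ ⟨w, hw, rfl⟩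
  exact hP0 μ w (h.det_ne_zero μ hμ) hw.2
    (h.isSubordinated hsub (Metric.ball_subset_closedBall hw.1))

theorem coeffValues_eq (h : IsCellRadius w₀ a₀ ε) {𝒞 : Configuration r}
    (hsub : IsSubordinated w₀ 𝒞) {μ₁ : Fin (2 * r) → ℂ} {w₁ : Fin r → ℂ}
    (hb : IsBasePoint (cell w₀ a₀ ε) w₀ μ₁ w₁) (p : 𝒞.Index) {μ : Fin (2 * r) → ℂ}
    (hμ : μ ∈ cell w₀ a₀ ε) :
    coeffValues 𝒞 (cell w₀ a₀ ε) μ₁ w₁ p μ =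
      (fun w => systemSolution 𝒞 w (initialMoments μ) p) '' localNodes w₀ ε μ := by
  ext y
  simp only [coeffValues, h.nodeValues_eq hb hμ, Set.mem_image]
  refine exists_congr fun w => and_congr_right fun hw => ?_
  have hs := solvesSystem_iff (h.isSubordinated hsub (Metric.ball_subset_closedBall hw.1)) hw.2
  simp only [hs, exists_eq_left]

end IsCellRadius

theorem IsContinuousMultivaluedOn.congr {A E : Type*} [TopologicalSpace A] [PseudoMetricSpace E]
    {F G : A → Set E} {U : Set A} (hF : IsContinuousMultivaluedOn F U) (h : ∀ a ∈ U, G a = F a) :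
    IsContinuousMultivaluedOn G U := by
  refine ⟨fun a ha => h a ha ▸ hF.nonempty a ha, fun a ha => h a ha ▸ hF.finite a ha,
    fun a ha ε hε => ?_, fun a ha ε hε => ?_⟩
  · filter_upwards [hF.lower a ha ε hε, self_mem_nhdsWithin] with b hb hbU
    rw [h a ha, h b hbU]
    exact hb
  · filter_upwards [hF.upper a ha ε hε, self_mem_nhdsWithin] with b hb hbU
    rw [h a ha, h b hbU]
    exact hb

theorem IsAlgebraicMultivaluedOn.congr {n : ℕ} {F G : (Fin n → ℂ) → Set ℂ} {U : Set (Fin n → ℂ)}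
    (hF : IsAlgebraicMultivaluedOn F U) (h : ∀ a ∈ U, G a = F a) :
    IsAlgebraicMultivaluedOn G U := by
  obtain ⟨p, hp, hp0⟩ := hF
  exact ⟨p, hp, fun μ hμ y hy => hp0 μ hμ y (h μ hμ ▸ hy)⟩

end Prony

end

/-! ### The main theorem, assembled on a cell around `μ₀`. -/

theorem mainTheorem4 (d r : ℕ) (hr : 1 ≤ r) (hrd : r ≤ d)
    (μ₀ : Fin (2 * r) → ℂ) (hμ₀ : μ₀ ∈ Prony.stratumStar d r hrd)
    (w₀ : Fin r → ℂ) (g₀ : (ℂ → ℂ) → ℂ) (hsol : Prony.IsPronySolution μ₀ w₀ g₀)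
    (𝒞 : Prony.Configuration r) (hsub : Prony.IsSubordinated w₀ 𝒞)
    (N : Set (Fin (2 * r) → ℂ)) (hN : N ∈ 𝓝 μ₀) :
    ∃ U : Set (Fin (2 * r) → ℂ), IsOpen U ∧ μ₀ ∈ U ∧ U ⊆ N ∧
      -- the Padé problem is uniquely solvable on `U`, and `w₀` enumerates the poles at `μ₀`
      (∀ μ ∈ U, ∃! R : ℂ[X] × ℂ[X], Prony.IsPade μ R.1 R.2) ∧
      Prony.IsPoleVector μ₀ w₀ ∧
      -- a starting point for the continuation of the nodes can be chosen
      (∃ μ₁ w₁, Prony.IsBasePoint U w₀ μ₁ w₁) ∧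
      -- whatever starting point is chosen:
      ∀ μ₁ w₁, Prony.IsBasePoint U w₀ μ₁ w₁ →
        -- `w(μ)` is a continuous multivalued algebraic function on `U` with `w(μ₀) = w₀`
        Prony.IsContinuousMultivaluedOn (Prony.nodeValues U μ₁ w₁) U ∧
        (∀ i, Prony.IsAlgebraicMultivaluedOn
          (fun μ => (fun w : Fin r → ℂ => w i) '' Prony.nodeValues U μ₁ w₁ μ) U) ∧
        Prony.nodeValues U μ₁ w₁ μ₀ = {w₀} ∧
        -- at every value `w` of `w(μ)`, the family `B_𝒞(w)` is a basis of `V_w`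
        (∀ μ ∈ U, ∀ w ∈ Prony.nodeValues U μ₁ w₁ μ,
          LinearIndependent ℂ (Prony.ddFamily 𝒞 w) ∧
          Submodule.span ℂ (Set.range (Prony.ddFamily 𝒞 w)) = Prony.signalSpace w) ∧
        -- the linear system has exactly one solution `β`, it depends continuously on `(μ, w)`, it is
        -- bounded, and it gives the solution of the Prony problem, unique up to reordering nodes
        (∃ β : (Fin (2 * r) → ℂ) × (Fin r → ℂ) → 𝒞.Index → ℂ,
          ContinuousOn β {q | q.1 ∈ U ∧ q.2 ∈ Prony.nodeValues U μ₁ w₁ q.1} ∧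
          (∃ K : ℝ, ∀ μ ∈ U, ∀ w ∈ Prony.nodeValues U μ₁ w₁ μ, ∀ p, ‖β (μ, w) p‖ ≤ K) ∧
          ∀ μ ∈ U, ∀ w ∈ Prony.nodeValues U μ₁ w₁ μ,
            (∀ b, Prony.SolvesSystem 𝒞 μ w b ↔ b = β (μ, w)) ∧
            Prony.IsPronySolution μ w (Prony.signalOf 𝒞 w (β (μ, w))) ∧
            (∃ P : ℂ[X], Prony.IsPade μ P (Prony.nodePoly w) ∧ ∀ z ∉ Set.range w,
              Prony.stieltjes (Prony.signalOf 𝒞 w (β (μ, w))) z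
                = P.eval z / (Prony.nodePoly w).eval z) ∧
            (∀ w' g', Prony.IsPronySolution μ w' g' →
              g' = Prony.signalOf 𝒞 w (β (μ, w)) ∧ ∃ σ : Equiv.Perm (Fin r), w' = w ∘ σ)) ∧
        -- the coefficients are continuous multivalued algebraic functions on `U`
        (∀ p : 𝒞.Index,
          Prony.IsContinuousMultivaluedOn (Prony.coeffValues 𝒞 U μ₁ w₁ p) U ∧
          Prony.IsAlgebraicMultivaluedOn (Prony.coeffValues 𝒞 U μ₁ w₁ p) U) := by
  have hdet := Prony.det_squareHankel_ne_zero_of_mem hμ₀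
  have hden₀ := hsol.isDenom
  set a₀ := Prony.initialMoments μ₀ with ha₀
  have hμ₀' : μ₀ = Prony.momentsOf w₀ a₀ := hden₀.eq_momentsOf
  have hdet' : (Prony.squareHankel (Prony.momentsOf w₀ a₀)).det ≠ 0 := hμ₀' ▸ hdet
  obtain ⟨ε, h, hUN⟩ := Prony.exists_isCellRadius hdet' (hμ₀' ▸ hN)
  have hmem₀ : μ₀ ∈ Prony.cell w₀ a₀ ε := Prony.mem_cell_iff.2
    ⟨Metric.mem_ball_self h.pos, w₀, Metric.mem_ball_self h.pos, hden₀⟩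
  refine ⟨Prony.cell w₀ a₀ ε, h.isOpen_cell, hmem₀, hUN,
    fun μ hμ => Prony.existsUnique_isPade (h.det_ne_zero μ hμ),
    (h.isPoleVector_iff hmem₀).2 hden₀, h.exists_isBasePoint, fun μ₁ w₁ hb => ?_⟩
  have hV : ∀ μ ∈ Prony.cell w₀ a₀ ε,
      Prony.nodeValues (Prony.cell w₀ a₀ ε) μ₁ w₁ μ = Prony.IsCellRadius.localNodes w₀ ε μ :=
    fun μ hμ => h.nodeValues_eq hb hμ
  have hsubw : ∀ μ ∈ Prony.cell w₀ a₀ ε,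
      ∀ w ∈ Prony.nodeValues (Prony.cell w₀ a₀ ε) μ₁ w₁ μ, Prony.IsSubordinated w 𝒞 :=
    fun μ hμ w hw => h.isSubordinated hsub (Metric.ball_subset_closedBall (hV μ hμ ▸ hw).1)
  have hβ := h.continuousOn_systemSolution hsub
  refine ⟨h.isContinuousMultivaluedOn_localNodes.congr hV, fun i =>
    (h.isAlgebraicMultivaluedOn_localNodes hdet' i).congr fun μ hμ => by rw [hV μ hμ],
    by rw [hV μ₀ hmem₀]; exact h.localNodes_center hdet hden₀, fun μ hμ w hw =>
    ⟨Prony.linearIndependent_ddFamily (hsubw μ hμ w hw),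
      Prony.span_ddFamily (hsubw μ hμ w hw)⟩,
    ⟨fun q => Prony.systemSolution 𝒞 q.2 (Prony.initialMoments q.1), ?_, ?_, ?_⟩,
    fun p => ⟨?_, ?_⟩⟩
  · exact hβ.mono fun q hq => ⟨hq.1, hV q.1 hq.1 ▸ hq.2⟩
  · obtain ⟨K, hK⟩ := h.exists_bound_systemSolution hsub
    exact ⟨K, fun μ hμ w hw => hK μ hμ w (hV μ hμ ▸ hw)⟩
  · intro μ hμ w hw
    have hs := hsubw μ hμ w hw
    have hdenw : Prony.IsDenom μ (Prony.nodePoly w) := (hV μ hμ ▸ hw).2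
    have hsolw : Prony.IsPronySolution μ w
        (Prony.signalOf 𝒞 w (Prony.systemSolution 𝒞 w (Prony.initialMoments μ))) := by
      rw [Prony.signalOf_systemSolution hs]
      exact hdenw.isPronySolution
    exact ⟨Prony.solvesSystem_iff hs hdenw, hsolw,
      ⟨_, hdenw.isPade (h.det_ne_zero μ hμ), fun z hz => hsolw.stieltjes_eq hz⟩,
      fun w' g' h' => hsolw.unique (h.det_ne_zero μ hμ) h'⟩
  · refine (h.isContinuousMultivaluedOn_localNodes.image (β := fun q =>
      Prony.systemSolution 𝒞 q.2 (Prony.initialMoments q.1) p) ?_).congr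
      fun μ hμ => h.coeffValues_eq hsub hb p hμ
    exact (continuous_apply p).comp_continuousOn hβ
  · exact (h.isAlgebraicMultivaluedOn_systemSolution hsub hdet' p).congr
      fun μ hμ => h.coeffValues_eq hsub hb p hμ
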